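/- For \(z\in\mathbb{C}\setminus(-\infty,0]\) (principal branch of \(\log\)), \(\lambda\in\mathbb{C}^*\) and \(a>0\), put \[ y_0(z,\lambda)=\sum_{j\ge 0}\frac{\lambda^{-2j}z^{4j}}{16^j(j!)^2},\qquad y_1(z,\lambda)=-2\lambda^{-1}\sum_{j\ge 1}\Bigl(1+\tfrac12+\cdots+\tfrac1j\Bigr)\frac{\lambda^{-2j}z^{4j}}{16^j(j!)^2}, \] \[ \phi(z,\lambda)=\begin{pmatrix}\sqrt{-a}&-\lambda/\sqrt{-a}\\0&1/\sqrt{-a}\end{pmatrix} \begin{pmatrix}1&0\\ \lambda^{-1}\log\frac z2&1\end{pmatrix} \begin{pmatrix}y_0&\lambda z\,\partial_z y_0\\ \frac14 y_1& y_0+\frac14\lambda z\,\partial_z y_1\end{pmatrix}, \qquad w(\lambda)=\begin{pmatrix}0&\lambda\\-\lambda^{-1}&0\end{pmatrix}, \] where \(\sqrt{-a}=i\sqrt a\). Let \(J=\mathrm{diag}(1,-1)\). Let \((\Lambda SL_2\mathbb{C})_\sigma\) be the group of smooth maps \(\gamma:S^1\to SL_2\mathbb{C}\) with \(\gamma(-\lambda)=J\gamma(\lambda)J\),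 let \((\Lambda SU_{1,1})_\sigma\) be its subgroup of loops with values in \(SU_{1,1}=\{A\in SL_2\mathbb{C}:\overline{A}^{\,t}JA=J\}\), and let \((\Lambda^{+,>0}SL_2\mathbb{C})_\sigma\) be its subgroup of loops that extend continuously to the closed unit disc, holomorphically and with values in \(SL_2\mathbb{C}\) on the open disc, and whose value at \(\lambda=0\) is \(\mathrm{diag}(\rho,\rho^{-1})\) for some \(\rho>0\). **Corollary 3.6 (local sinh-Gordon solution).** Let \(W\subset\mathbb{C}\) be an open neighbourhood of \(0\) and \(U=W\cap(\mathbb{C}\setminus(-\infty,0])\). Let \(\phi=F\,w\,B\) be an Iwasawa factorization on \(U\), that is, for every \(z\in U\), \(F(z,\cdot)\in(\Lambda SU_{1,1})_\sigma\), \(B(z,\cdot)\in(\Lambda^{+,>0}SL_2\mathbb{C})_\sigma\) and \(\phi(z,\lambda)=F(z,\lambda)w(\lambda)B(z,\lambda)\) for all \(\lambda\in S^1\). Define \(v:U\to\mathbb{R}\) by \(B(z,\lambda=0)=\mathrm{diag}(e^{v/2},e^{-v/2})\). Then \(v\) is radial, i.e. \(v(z)=v(r)\) depends only on \(r=|z|\);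 as a function of \(r\in\{|z|:z\in U\}\) it is twice continuously differentiable and satisfies \[ \frac14\Bigl(v_{rr}+\frac1r v_r\Bigr)-r^6e^{2v}+r^{-2}e^{-2v}=0; \] and \(e^{v/2}\sim\sqrt{-a-2\log r}\) as \(r\to0\), i.e. the quotient of the two sides tends to \(1\). -/

import Mathlib

open scoped Matrix ContDiff Topology

noncomputable section

namespace SmythDPW

/-- Complex `2 × 2` matrices. -/
abbrev M2 : Type := Matrix (Fin 2) (Fin 2) ℂ

/-- The matrix `diag(1, -1)`. -/
def J : M2 := !![1, 0; 0, -1]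

/-- The involution `σ(γ) = diag(1, -1) γ diag(1, -1)`. -/
def sigma (A : M2) : M2 := J * A * J

/-- `A` belongs to `SU(1,1)`. -/
def IsSU11 (A : M2) : Prop := A.det = 1 ∧ Aᴴ * J * A = J

/-- The twisted loop group of `SL(2, ℂ)`: smooth maps `γ` from the unit circle to `SL(2, ℂ)` with
`γ(-lam) = σ(γ(lam))`. A loop is given by a function on `ℂ` of which only the values on the unit
circle matter; smoothness on the circle is smoothness in the angle. -/
def IsLoop (γ : ℂ → M2) : Prop :=
  (∀ i j : Fin 2, ContDiff ℝ ∞ (fun θ : ℝ => γ (Complex.exp (θ * Complex.I)) i j)) ∧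
  (∀ lam : ℂ, ‖lam‖ = 1 → (γ lam).det = 1) ∧
  (∀ lam : ℂ, ‖lam‖ = 1 → γ (-lam) = sigma (γ lam))

/-- The twisted loop group of `SU(1,1)`. -/
def IsLoopSU11 (γ : ℂ → M2) : Prop :=
  IsLoop γ ∧ ∀ lam : ℂ, ‖lam‖ = 1 → IsSU11 (γ lam)

/-- The loops that extend holomorphically to a map from the open unit disc to `SL(2, ℂ)`. The
function `γ` is the loop on the unit circle together with its extension to the disc (continuous up
to the circle); its values outside the closed disc do not matter. -/
def IsPlusLoop (γ : ℂ → M2) : Prop :=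
  IsLoop γ ∧
  (∀ i j : Fin 2, ContinuousOn (fun lam : ℂ => γ lam i j) (Metric.closedBall 0 1)) ∧
  (∀ i j : Fin 2, DifferentiableOn ℂ (fun lam : ℂ => γ lam i j) (Metric.ball 0 1)) ∧
  (∀ lam ∈ Metric.ball (0 : ℂ) 1, (γ lam).det = 1)

/-- The plus loops whose value at `lam = 0` is `diag(ρ, ρ⁻¹)` for some real `ρ > 0`. -/
def IsPosPlusLoop (γ : ℂ → M2) : Prop :=
  IsPlusLoop γ ∧ ∃ ρ : ℝ, 0 < ρ ∧ γ 0 = !![(ρ : ℂ), 0; 0, (ρ : ℂ)⁻¹]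

/-- The loop `w`. -/
def w (lam : ℂ) : M2 := !![0, lam; -lam⁻¹, 0]

/-- `y₀(z, lam) = ∑_{j ≥ 0} lam^{-2j} z^{4j} / (16^j (j!)²)`. -/
def y0 (z lam : ℂ) : ℂ :=
  ∑' j : ℕ, (lam⁻¹) ^ (2 * j) * z ^ (4 * j) / (16 ^ j * (Nat.factorial j : ℂ) ^ 2)

/-- `y₁(z, lam) = -2 lam⁻¹ ∑_{j ≥ 1} (1 + ⋯ + 1/j) lam^{-2j} z^{4j} / (16^j (j!)²)`
(the term `j = 0` vanishes, since the harmonic number `0` is zero). -/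
def y1 (z lam : ℂ) : ℂ :=
  -2 * lam⁻¹ * ∑' j : ℕ,
    ((harmonic j : ℚ) : ℂ) * ((lam⁻¹) ^ (2 * j) * z ^ (4 * j) / (16 ^ j * (Nat.factorial j : ℂ) ^ 2))

/-- The square root `√(-a) = i √a`, for `a > 0`. -/
def sqrtNeg (a : ℝ) : ℂ := Complex.I * (Real.sqrt a : ℂ)

/-- The canonical solution `L` for the potential `lam⁻¹ (0, z³; z⁻¹, 0) dz`, with the principal
branch of the logarithm. -/
def L (z lam : ℂ) : M2 :=
  !![1, 0; lam⁻¹ * Complex.log (z / 2), 1] *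
  !![y0 z lam, lam * z * deriv (fun x : ℂ => y0 x lam) z;
     (1 / 4) * y1 z lam, y0 z lam + lam * z * ((1 / 4) * deriv (fun x : ℂ => y1 x lam) z)]

/-- The dressed solution `φ`. -/
def phi (a : ℝ) (z lam : ℂ) : M2 :=
  !![sqrtNeg a, -lam / sqrtNeg a; 0, 1 / sqrtNeg a] * L z lam

/-- `G = F w B` is an Iwasawa factorization on the set `U` of parameters `z`: for every `z ∈ U`,
`F(z, ·)` lies in the twisted loop group of `SU(1,1)`, `B(z, ·)` is a plus loop with
`B(z, 0) = diag(ρ, ρ⁻¹)`, `ρ > 0`, and the product formula holds on the unit circle. -/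
def IsIwasawaOn (G F B : ℂ → ℂ → M2) (U : Set ℂ) : Prop :=
  ∀ z ∈ U, IsLoopSU11 (F z) ∧ IsPosPlusLoop (B z) ∧
    ∀ lam : ℂ, ‖lam‖ = 1 → G z lam = F z lam * w lam * B z lam

end SmythDPW

end

noncomputable section

namespace SmythDPW

open Complex Metric Real

/-! Write `*` for the conjugate transpose. Since `F` preserves `J` and `w* J w = -J`, the
factorization `φ = F w B` gives `B* J B = -φ* J φ` on the circle (`conjTranspose_plus_mul_J`). The
right side is an explicit Hermitian loop and `B` is the only unknown. Nothing is known in advance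
about how `B` depends on `z`, so the regularity of `v` has to come from this equation.

The equation is studied through `P = B₂ B₁⁻¹`, which satisfies `P* J P = J + D` with `D` small. As
`det P = 1`, the first row of `P` is the conjugate of the second up to an error linear in `D`. The
entries are holomorphic in the disc, so averages of their products are values at `0`, and this gives
`L²` bounds linear in `D` (`IsDiscMap.avg_row_le`). Averaging the row identities then yields `ρ -
ρ⁻¹` and the off-diagonal Taylor coefficients of order one, linearly in `D` up to a quadratic error
(`IsDiscMap.stability`). This one estimate gives uniqueness (`IsDiscMap.unique`), differentiability
with a first variation formula (`hasDerivAt_factorization`), and the asymptotics.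

In the coordinate `ζ = log z` the solution satisfies `φ' = φ X` with `X = λ⁻¹ (0, z⁴; 1, 0)`. The
first variation expresses the derivative of `log ρ` by the coefficients of order one of `B`. Their
own derivatives involve two unknown numbers of order two, each multiplying the direction linearly.
Rotating `z` by an angle `α` and `λ` by `2α` only conjugates the Hermitian loop by a diagonal matrix
(`gram_rotate`), so by uniqueness `ρ`, the upper coefficient and `z⁴` times the lower one depend
only on `s = Re ζ`. The vanishing of their derivatives in the direction `i` determines the unknown
numbers, and the direction `1` gives a closed system (`IsPlusFamily.hasDerivAt_radial`). It amounts
to `v_ss = 4 (e^{8s} e^{2v} - e^{-2v})`, the required equation in the variable `s = log r`.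

As `r → 0` the Hermitian loop is close to a form with corner `c = -a - 2 log (r/2)`, whose plus
factor is explicit with `ρ = √c`. The stability estimate compares it with `B`, with an error of
order `c r⁴` (`abs_div_sqrt_height_sub_one_le`). -/

/-- The average of a function over the unit circle. -/
abbrev avg {E : Type*} [NormedAddCommGroup E] [NormedSpace ℝ E] (f : ℂ → E) : E :=
  Real.circleAverage f 0 1

/-! ### Circle averages and Cauchy's formula. -/

section Averages

theorem circleIntegrable_of_continuousOn {E : Type*} [NormedAddCommGroup E] {f : ℂ → E}
    (hf : ContinuousOn f (sphere 0 1)) : CircleIntegrable f 0 1 :=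
  hf.circleIntegrable zero_le_one

theorem avg_congr {E : Type*} [NormedAddCommGroup E] [NormedSpace ℝ E] {f g : ℂ → E}
    (h : ∀ l ∈ sphere (0 : ℂ) 1, f l = g l) : avg f = avg g :=
  circleAverage_congr_sphere (by simpa [Set.EqOn] using h)

theorem avg_re {f : ℂ → ℂ} (hf : ContinuousOn f (sphere 0 1)) :
    avg (fun l => (f l).re) = (avg f).re := by
  simpa [Function.comp_def] using
    (ContinuousLinearMap.circleAverage_comp_comm Complex.reCLM
      (circleIntegrable_of_continuousOn hf))

theorem avg_conj {f : ℂ → ℂ} (hf : ContinuousOn f (sphere 0 1)) :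
    avg (fun l => (starRingEnd ℂ) (f l)) = (starRingEnd ℂ) (avg f) := by
  simpa [Function.comp_def] using
    (ContinuousLinearMap.circleAverage_comp_comm (Complex.conjCLE : ℂ →L[ℝ] ℂ)
      (circleIntegrable_of_continuousOn hf))

theorem avg_add {E : Type*} [NormedAddCommGroup E] [NormedSpace ℝ E] {f g : ℂ → E}
    (hf : ContinuousOn f (sphere 0 1)) (hg : ContinuousOn g (sphere 0 1)) :
    avg (fun l => f l + g l) = avg f + avg g :=
  circleAverage_fun_add (circleIntegrable_of_continuousOn hf) (circleIntegrable_of_continuousOn hg)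

theorem avg_sub {E : Type*} [NormedAddCommGroup E] [NormedSpace ℝ E] {f g : ℂ → E}
    (hf : ContinuousOn f (sphere 0 1)) (hg : ContinuousOn g (sphere 0 1)) :
    avg (fun l => f l - g l) = avg f - avg g :=
  circleAverage_fun_sub (circleIntegrable_of_continuousOn hf) (circleIntegrable_of_continuousOn hg)

theorem avg_const_mul (c : ℂ) (f : ℂ → ℂ) : avg (fun l => c * f l) = c * avg f := by
  simpa using (circleAverage_fun_smul (a := c) (f := f) (c := 0) (R := 1))

theorem avg_const_mul_real (c : ℝ) (f : ℂ → ℝ) : avg (fun l => c * f l) = c * avg f := by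
  simpa using (circleAverage_fun_smul (a := c) (f := f) (c := 0) (R := 1))

theorem avg_const {E : Type*} [NormedAddCommGroup E] [NormedSpace ℝ E] [CompleteSpace E] (c : E) :
    avg (fun _ => c) = c :=
  circleAverage_const c 0 1

theorem avg_mono {f g : ℂ → ℝ} (hf : ContinuousOn f (sphere 0 1))
    (hg : ContinuousOn g (sphere 0 1)) (h : ∀ l ∈ sphere (0 : ℂ) 1, f l ≤ g l) :
    avg f ≤ avg g :=
  circleAverage_mono (circleIntegrable_of_continuousOn hf) (circleIntegrable_of_continuousOn hg)
    (by simpa using h)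

theorem avg_nonneg {f : ℂ → ℝ} (h : ∀ l ∈ sphere (0 : ℂ) 1, 0 ≤ f l) : 0 ≤ avg f :=
  circleAverage_nonneg_of_nonneg (by simpa using h)

theorem norm_avg_le (f : ℂ → ℂ) : ‖avg f‖ ≤ avg (fun l => ‖f l‖) := by
  simp only [avg, circleAverage_def, norm_smul, smul_eq_mul]
  have h : (0 : ℝ) ≤ (2 * π)⁻¹ := by positivity
  rw [Real.norm_of_nonneg h]
  gcongr
  exact intervalIntegral.norm_integral_le_integral_norm (by positivity)

theorem avg_sq_le {f : ℂ → ℝ} (hf : ContinuousOn f (sphere 0 1)) :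
    (avg f) ^ 2 ≤ avg (fun l => f l ^ 2) := by
  have h : 0 ≤ avg (fun l => (f l - avg f) ^ 2) := avg_nonneg fun l _ => sq_nonneg _
  have e : avg (fun l => (f l - avg f) ^ 2)
      = avg (fun l => f l ^ 2) - 2 * avg f * avg f + avg f ^ 2 := by
    have : (fun l => (f l - avg f) ^ 2)
        = fun l => (f l ^ 2 - (2 * avg f) * f l) + avg f ^ 2 := by
      ext l; ring
    rw [this, avg_add (by fun_prop) (by fun_prop), avg_sub (by fun_prop) (by fun_prop),
      avg_const_mul_real, avg_const]
  nlinarith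

theorem avg_eq_apply_zero {f : ℂ → ℂ} (hf : DiffContOnCl ℂ f (ball 0 1)) : avg f = f 0 := by
  have h : DiffContOnCl ℂ f (ball 0 |1|) := by simpa using hf
  have := DiffContOnCl.circleAverage_smul_div (c := 0) (R := 1) (w := 0) h (by simp)
  rw [← this]
  refine avg_congr fun l hl => ?_
  have : l ≠ 0 := ne_of_mem_sphere hl one_ne_zero
  simp [this]

theorem avg_inv_mul_eq_deriv {f : ℂ → ℂ} (hf : DiffContOnCl ℂ f (ball 0 1)) :
    avg (fun l => l⁻¹ * f l) = deriv f 0 := by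
  have h := hf.deriv_eq_smul_circleIntegral one_pos
  rw [avg, circleAverage_eq_circleIntegral one_ne_zero]
  have e : (∮ z in C(0, 1), (z - 0)⁻¹ • (z⁻¹ * f z)) = ∮ z in C(0, 1), (1 / (z - 0) ^ 2) • f z := by
    refine circleIntegral.integral_congr zero_le_one fun l _ => ?_
    simp [sq, mul_assoc]
  rw [e, h, smul_smul, inv_mul_cancel₀ Complex.two_pi_I_ne_zero, one_smul]

theorem DiffContOnCl.mul' {f g : ℂ → ℂ} (hf : DiffContOnCl ℂ f (ball 0 1))
    (hg : DiffContOnCl ℂ g (ball 0 1)) : DiffContOnCl ℂ (fun l => f l * g l) (ball 0 1) :=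
  hf.smul hg

theorem continuousOn_sphere_of_diffContOnCl {f : ℂ → ℂ} (hf : DiffContOnCl ℂ f (ball 0 1)) :
    ContinuousOn f (sphere 0 1) :=
  hf.continuousOn_ball.mono sphere_subset_closedBall

theorem conj_eq_inv_of_mem_sphere {l : ℂ} (hl : l ∈ sphere (0 : ℂ) 1) :
    (starRingEnd ℂ) l = l⁻¹ := by
  rw [Complex.inv_def, Complex.normSq_eq_norm_sq]
  simp [mem_sphere_zero_iff_norm.1 hl]

/-- On the circle `λ⁻¹` is the conjugate of `λ`, so the integrand is the conjugate of `λ f(λ)`,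
which vanishes at `0`. This separates holomorphic from antiholomorphic contributions. -/
theorem avg_inv_mul_conj {f : ℂ → ℂ} (hf : DiffContOnCl ℂ f (ball 0 1)) :
    avg (fun l => l⁻¹ * (starRingEnd ℂ) (f l)) = 0 := by
  have hid : DiffContOnCl ℂ (fun l : ℂ => l) (ball 0 1) := differentiable_fun_id.diffContOnCl
  have h : avg (fun l => (starRingEnd ℂ) (l * f l)) = 0 := by
    have := continuousOn_sphere_of_diffContOnCl hf
    rw [avg_conj (by fun_prop), avg_eq_apply_zero (DiffContOnCl.mul' hid hf)]
    simp
  rw [← h]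
  exact avg_congr fun l hl => by rw [map_mul, conj_eq_inv_of_mem_sphere hl]

end Averages

/-! ### The factorization problem near the identity. -/

theorem matrix_ext_two {A B : M2} (h00 : A 0 0 = B 0 0) (h01 : A 0 1 = B 0 1)
    (h10 : A 1 0 = B 1 0) (h11 : A 1 1 = B 1 1) : A = B := by
  ext i j; fin_cases i <;> fin_cases j <;> assumption

theorem conjTranspose_mul_mul_apply (A H : M2) (i j : Fin 2) :
    (Aᴴ * H * A) i j = ∑ k, ∑ m, (starRingEnd ℂ) (A m i) * H m k * A k j := by
  simp [Matrix.mul_apply]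
  ring

/-- If `Pᴴ J P = J + D` with `det P = 1`, the first row of `P` is the conjugate of the second one
up to an error that is linear in `D`. -/
theorem row_of_conjTranspose_mul_J_mul {P D : M2} (hdet : P.det = 1) (h : Pᴴ * J * P = J + D) :
    P 0 0 - (starRingEnd ℂ) (P 1 1)
        = (starRingEnd ℂ) (P 1 1) * D 0 0 - (starRingEnd ℂ) (P 1 0) * D 1 0 ∧
      P 0 1 - (starRingEnd ℂ) (P 1 0)
        = (starRingEnd ℂ) (P 1 1) * D 0 1 - (starRingEnd ℂ) (P 1 0) * D 1 1 := by
  have e (i j : Fin 2) := congrFun (congrFun h i) j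
  have e00 := e 0 0
  have e01 := e 0 1
  have e10 := e 1 0
  have e11 := e 1 1
  -- The conjugated determinant allows solving the entries of `Pᴴ J P` for the first row, as in
  -- Cramer's rule.
  have hd : (starRingEnd ℂ) (P 0 0) * (starRingEnd ℂ) (P 1 1)
      - (starRingEnd ℂ) (P 0 1) * (starRingEnd ℂ) (P 1 0) = 1 := by
    rw [Matrix.det_fin_two] at hdet
    simpa using congrArg (starRingEnd ℂ) hdet
  simp only [J, Matrix.mul_apply, Fin.sum_univ_two, Matrix.conjTranspose_apply, Matrix.add_apply,
    Matrix.of_apply, Matrix.cons_val', Matrix.cons_val_zero, Matrix.cons_val_one,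
    Matrix.cons_val_fin_one, RCLike.star_def] at e00 e01 e10 e11
  constructor
  · linear_combination (starRingEnd ℂ) (P 1 1) * e00 - (starRingEnd ℂ) (P 1 0) * e10 - P 0 0 * hd
  · linear_combination (starRingEnd ℂ) (P 1 1) * e01 - (starRingEnd ℂ) (P 1 0) * e11 - P 0 1 * hd

theorem norm_row_error_sq_le {s r x y : ℂ} {ε : ℝ} (hx : ‖x‖ ≤ ε) (hy : ‖y‖ ≤ ε) :
    ‖(starRingEnd ℂ) s * x - (starRingEnd ℂ) r * y‖ ^ 2 ≤ 2 * ε ^ 2 * (‖s‖ ^ 2 + ‖r‖ ^ 2) := by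
  have h1 : ‖(starRingEnd ℂ) s * x - (starRingEnd ℂ) r * y‖ ≤ ε * (‖s‖ + ‖r‖) := by
    refine (norm_sub_le _ _).trans ?_
    simp only [norm_mul, RCLike.norm_conj]
    nlinarith [norm_nonneg s, norm_nonneg r]
  have h2 : 0 ≤ ‖(starRingEnd ℂ) s * x - (starRingEnd ℂ) r * y‖ := norm_nonneg _
  have h3 : (ε * (‖s‖ + ‖r‖)) ^ 2 ≤ 2 * ε ^ 2 * (‖s‖ ^ 2 + ‖r‖ ^ 2) := by
    nlinarith [mul_nonneg (sq_nonneg ε) (sq_nonneg (‖s‖ - ‖r‖))]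
  exact (pow_le_pow_left₀ h2 h1 2).trans h3

/-- The cross term is `p s`, without a conjugate: for holomorphic `p` and `s` its average is the
value at `0`. -/
theorem norm_sub_conj_sq (p s : ℂ) :
    ‖p - (starRingEnd ℂ) s‖ ^ 2 = ‖p‖ ^ 2 + ‖s‖ ^ 2 - 2 * (p * s).re := by
  simp only [← Complex.normSq_eq_norm_sq, Complex.normSq_apply]
  simp
  ring

/-- A function on the disc with values in `SL(2, ℂ)`, holomorphic inside and continuous up to the
circle, whose value at `0` is `diag(ρ, ρ⁻¹)` with `ρ > 0`. -/
structure IsDiscMap (B : ℂ → M2) (ρ : ℝ) : Prop where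
  diffContOnCl : ∀ i j, DiffContOnCl ℂ (fun l => B l i j) (ball 0 1)
  det : ∀ l ∈ sphere (0 : ℂ) 1, (B l).det = 1
  pos : 0 < ρ
  zero : B 0 = !![(ρ : ℂ), 0; 0, (ρ : ℂ)⁻¹]

theorem IsDiscMap.continuousOn {B : ℂ → M2} {ρ : ℝ} (h : IsDiscMap B ρ) (i j : Fin 2) :
    ContinuousOn (fun l => B l i j) (sphere 0 1) :=
  continuousOn_sphere_of_diffContOnCl (h.diffContOnCl i j)

/-- `L²` bounds on the second row of a disc map that is almost unitary on the circle. -/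
theorem IsDiscMap.avg_row_le {P D : ℂ → M2} {ρ ε : ℝ} (hP : IsDiscMap P ρ)
    (hPD : ∀ l ∈ sphere (0 : ℂ) 1, (P l)ᴴ * J * P l = J + D l)
    (hD : ∀ l ∈ sphere (0 : ℂ) 1, ∀ i j, ‖D l i j‖ ≤ ε) (hε0 : 0 ≤ ε) (hε : ε ≤ 1 / 4) :
    avg (fun l => ‖P l 1 1 - 1‖) ≤ 4 * ε ∧ avg (fun l => ‖P l 1 0‖) ≤ 4 * ε := by
  have c00 := hP.continuousOn 0 0
  have c01 := hP.continuousOn 0 1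
  have c10 := hP.continuousOn 1 0
  have c11 := hP.continuousOn 1 1
  have hρ := hP.pos
  have hρ' : (ρ : ℂ) ≠ 0 := by exact_mod_cast hρ.ne'
  have z00 : P 0 0 0 = ρ := by simp [hP.zero]
  have z01 : P 0 0 1 = 0 := by simp [hP.zero]
  have z10 : P 0 1 0 = 0 := by simp [hP.zero]
  have z11 : P 0 1 1 = (ρ : ℂ)⁻¹ := by simp [hP.zero]
  set p2 := avg (fun l => ‖P l 0 0‖ ^ 2) with hp2
  set q2 := avg (fun l => ‖P l 0 1‖ ^ 2) with hq2
  set r2 := avg (fun l => ‖P l 1 0‖ ^ 2) with hr2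
  set s2 := avg (fun l => ‖P l 1 1‖ ^ 2) with hs2
  have e1 : avg (fun l => ‖P l 0 0 - (starRingEnd ℂ) (P l 1 1)‖ ^ 2) = p2 + s2 - 2 := by
    have : avg (fun l => P l 0 0 * P l 1 1) = 1 := by
      rw [avg_eq_apply_zero (DiffContOnCl.mul' (hP.diffContOnCl 0 0) (hP.diffContOnCl 1 1)), z00,
        z11, mul_inv_cancel₀ hρ']
    simp only [norm_sub_conj_sq]
    rw [avg_sub (by fun_prop) (by fun_prop), avg_add (by fun_prop) (by fun_prop),
      avg_const_mul_real, avg_re (by fun_prop), this]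
    simp [hp2, hs2]
  have e2 : avg (fun l => ‖P l 0 1 - (starRingEnd ℂ) (P l 1 0)‖ ^ 2) = q2 + r2 := by
    have : avg (fun l => P l 0 1 * P l 1 0) = 0 := by
      rw [avg_eq_apply_zero (DiffContOnCl.mul' (hP.diffContOnCl 0 1) (hP.diffContOnCl 1 0)), z01,
        z10, mul_zero]
    simp only [norm_sub_conj_sq]
    rw [avg_sub (by fun_prop) (by fun_prop), avg_add (by fun_prop) (by fun_prop),
      avg_const_mul_real, avg_re (by fun_prop), this]
    simp [hq2, hr2]
  have e3 : avg (fun l => 2 * ε ^ 2 * (‖P l 1 1‖ ^ 2 + ‖P l 1 0‖ ^ 2)) = 2 * ε ^ 2 * (s2 + r2) := by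
    rw [avg_const_mul_real, avg_add (by fun_prop) (by fun_prop)]
  have i1 : p2 + s2 - 2 ≤ 2 * ε ^ 2 * (s2 + r2) := by
    rw [← e1, ← e3]
    refine avg_mono (by fun_prop) (by fun_prop) fun l hl => ?_
    rw [(row_of_conjTranspose_mul_J_mul (hP.det l hl) (hPD l hl)).1]
    exact norm_row_error_sq_le (hD l hl _ _) (hD l hl _ _)
  have i2 : q2 + r2 ≤ 2 * ε ^ 2 * (s2 + r2) := by
    rw [← e2, ← e3]
    refine avg_mono (by fun_prop) (by fun_prop) fun l hl => ?_
    rw [(row_of_conjTranspose_mul_J_mul (hP.det l hl) (hPD l hl)).2]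
    exact norm_row_error_sq_le (hD l hl _ _) (hD l hl _ _)
  have hq0 : 0 ≤ q2 := avg_nonneg fun l _ => sq_nonneg _
  have hr0 : 0 ≤ r2 := avg_nonneg fun l _ => sq_nonneg _
  have hp0 : ρ ^ 2 ≤ p2 := by
    have h1 := norm_avg_le (fun l => P l 0 0)
    rw [avg_eq_apply_zero (hP.diffContOnCl 0 0), z00, Complex.norm_of_nonneg hρ.le] at h1
    have h2 := avg_sq_le (f := fun l => ‖P l 0 0‖) (by fun_prop)
    exact (pow_le_pow_left₀ hρ.le h1 2).trans h2
  have hs0 : ρ⁻¹ ^ 2 ≤ s2 := by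
    have h1 := norm_avg_le (fun l => P l 1 1)
    rw [avg_eq_apply_zero (hP.diffContOnCl 1 1), z11, norm_inv, Complex.norm_of_nonneg hρ.le] at h1
    have h2 := avg_sq_le (f := fun l => ‖P l 1 1‖) (by fun_prop)
    exact (pow_le_pow_left₀ (by positivity) h1 2).trans h2
  have hε2 : ε ^ 2 ≤ 1 / 16 := by nlinarith
  -- Since `2 ε² ≤ 1/8`, the sum of `i1` and `i2` absorbs its right side and leaves `(3/4)(s2 + r2)
  -- ≤ 2`.
  have hA : s2 + r2 ≤ 3 := by nlinarith [sq_nonneg ρ, sq_nonneg ρ⁻¹]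
  have hA0 : 0 ≤ s2 + r2 := by nlinarith [sq_nonneg ρ⁻¹]
  have j1 : p2 + s2 - 2 ≤ 6 * ε ^ 2 := by nlinarith
  have j2 : r2 ≤ 6 * ε ^ 2 := by nlinarith
  -- With `ρ² ≤ p2` and `j1`, this eliminates `ρ` from `s2 + 1 - 2 ρ⁻¹` and bounds it by `6 ε² ≤ (4
  -- ε)²`.
  have am : 3 ≤ ρ ^ 2 + 2 * ρ⁻¹ := by
    have : ρ ^ 2 + 2 * ρ⁻¹ - 3 = (ρ - 1) ^ 2 * (ρ + 2) * ρ⁻¹ := by field_simp; ring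
    have : 0 ≤ (ρ - 1) ^ 2 * (ρ + 2) * ρ⁻¹ := by positivity
    linarith
  have e4 : avg (fun l => ‖P l 1 1 - 1‖ ^ 2) = s2 + 1 - 2 * ρ⁻¹ := by
    have : ∀ x : ℂ, ‖x - 1‖ ^ 2 = ‖x‖ ^ 2 + 1 - 2 * x.re := fun x => by
      simpa using norm_sub_conj_sq x 1
    simp only [this]
    rw [avg_sub (by fun_prop) (by fun_prop), avg_add (by fun_prop) (by fun_prop),
      avg_const_mul_real, avg_re (by fun_prop), avg_eq_apply_zero (hP.diffContOnCl 1 1), z11,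
      avg_const, ← Complex.ofReal_inv, Complex.ofReal_re]
  constructor
  · have h := avg_sq_le (f := fun l => ‖P l 1 1 - 1‖) (by fun_prop)
    rw [e4] at h
    nlinarith
  · have h := avg_sq_le (f := fun l => ‖P l 1 0‖) (by fun_prop)
    nlinarith

/-- In mean, `(s, r)` is within `4 ε` of `(1, 0)` in each component, so replacing it by `(1, 0)`
costs at most `ε (4 ε + 4 ε)`. -/
theorem norm_avg_row_error_le {s r x y u : ℂ → ℂ} {ε : ℝ} (hs : ContinuousOn s (sphere 0 1))
    (hr : ContinuousOn r (sphere 0 1)) (hx : ContinuousOn x (sphere 0 1))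
    (hy : ContinuousOn y (sphere 0 1)) (hu : ContinuousOn u (sphere 0 1))
    (hxε : ∀ l ∈ sphere (0 : ℂ) 1, ‖x l‖ ≤ ε) (hyε : ∀ l ∈ sphere (0 : ℂ) 1, ‖y l‖ ≤ ε)
    (hu1 : ∀ l ∈ sphere (0 : ℂ) 1, ‖u l‖ = 1) (hε : 0 ≤ ε)
    (hs1 : avg (fun l => ‖s l - 1‖) ≤ 4 * ε) (hr1 : avg (fun l => ‖r l‖) ≤ 4 * ε) :
    ‖avg (fun l => u l * (s l * x l - r l * y l)) - avg (fun l => u l * x l)‖ ≤ 8 * ε ^ 2 := by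
  rw [← avg_sub (by fun_prop) (by fun_prop)]
  refine (norm_avg_le _).trans ?_
  have : avg (fun l => ε * (‖s l - 1‖ + ‖r l‖)) ≤ 8 * ε ^ 2 := by
    rw [avg_const_mul_real, avg_add (by fun_prop) (by fun_prop)]
    nlinarith
  refine (avg_mono (by fun_prop) (by fun_prop) fun l hl => ?_).trans this
  have e : u l * (s l * x l - r l * y l) - u l * x l = u l * ((s l - 1) * x l - r l * y l) := by
    ring
  rw [e, norm_mul, hu1 l hl, one_mul]
  refine (norm_sub_le _ _).trans ?_
  rw [norm_mul, norm_mul]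
  nlinarith [hxε l hl, hyε l hl, norm_nonneg (s l - 1), norm_nonneg (r l)]

/-- Linearization of the factorization problem `Pᴴ J P = J + D` at `P = 1`. -/
theorem IsDiscMap.stability {P D : ℂ → M2} {ρ ε : ℝ} (hP : IsDiscMap P ρ)
    (hPD : ∀ l ∈ sphere (0 : ℂ) 1, (P l)ᴴ * J * P l = J + D l)
    (hD : ∀ l ∈ sphere (0 : ℂ) 1, ∀ i j, ‖D l i j‖ ≤ ε) (hε0 : 0 ≤ ε) (hε : ε ≤ 1 / 4) :
    ‖((ρ - ρ⁻¹ : ℝ) : ℂ) - avg (fun l => D l 0 0)‖ ≤ 8 * ε ^ 2 ∧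
    ‖deriv (fun l => P l 0 1) 0 - avg (fun l => l⁻¹ * D l 0 1)‖ ≤ 8 * ε ^ 2 ∧
    ‖deriv (fun l => P l 1 0) 0 + avg (fun l => l⁻¹ * (starRingEnd ℂ) (D l 0 1))‖ ≤ 8 * ε ^ 2 := by
  obtain ⟨hs1, hr1⟩ := hP.avg_row_le hPD hD hε0 hε
  have c00 := hP.continuousOn 0 0
  have c01 := hP.continuousOn 0 1
  have c10 := hP.continuousOn 1 0
  have c11 := hP.continuousOn 1 1
  -- Continuity of `D` is no hypothesis; it is read off from the equation.
  have hDc : ∀ i j, ContinuousOn (fun l => D l i j) (sphere 0 1) := by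
    intro i j
    have h : ContinuousOn (fun l => ((P l)ᴴ * J * P l) i j - J i j) (sphere 0 1) := by
      simp only [conjTranspose_mul_mul_apply]
      refine ContinuousOn.sub (continuousOn_finsetSum _ fun k _ => continuousOn_finsetSum _
        fun m _ => ?_) continuousOn_const
      exact ((Complex.continuous_conj.comp_continuousOn (hP.continuousOn m i)).mul
        continuousOn_const).mul (hP.continuousOn k j)
    exact h.congr fun l hl => by simp [hPD l hl]
  have d00 := hDc 0 0
  have d01 := hDc 0 1
  have d10 := hDc 1 0
  have d11 := hDc 1 1
  have cinv : ContinuousOn (fun l : ℂ => l⁻¹) (sphere 0 1) :=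
    continuousOn_inv₀.mono fun l hl => ne_of_mem_sphere hl one_ne_zero
  have row := fun l (hl : l ∈ sphere (0 : ℂ) 1) =>
    row_of_conjTranspose_mul_J_mul (hP.det l hl) (hPD l hl)
  have hconj : ∀ x : ℂ, ‖(starRingEnd ℂ) x - 1‖ = ‖x - 1‖ := fun x => by
    rw [← RCLike.norm_conj (x - 1), map_sub, map_one]
  have hs1' : avg (fun l => ‖(starRingEnd ℂ) (P l 1 1) - 1‖) ≤ 4 * ε := by simpa only [hconj]
  have hr1' : avg (fun l => ‖(starRingEnd ℂ) (P l 1 0)‖) ≤ 4 * ε := by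
    simpa only [RCLike.norm_conj]
  have hinv : ∀ l ∈ sphere (0 : ℂ) 1, ‖l⁻¹‖ = 1 := fun l hl => by
    rw [norm_inv, mem_sphere_zero_iff_norm.1 hl, inv_one]
  refine ⟨?_, ?_, ?_⟩
  · have h := norm_avg_row_error_le (u := fun _ => 1) (by fun_prop) (by fun_prop) d00 d10
      (by fun_prop) (fun l hl => hD l hl 0 0) (fun l hl => hD l hl 1 0) (by simp) hε0 hs1' hr1'
    simp only [one_mul] at h
    rw [← avg_congr (fun l hl => (row l hl).1), avg_sub (by fun_prop) (by fun_prop),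
      avg_conj c11, avg_eq_apply_zero (hP.diffContOnCl 0 0),
      avg_eq_apply_zero (hP.diffContOnCl 1 1), hP.zero] at h
    simpa using h
  -- The weight `λ⁻¹` extracts the derivative of the upper entry and kills the conjugate of the
  -- lower one; the last case uses the conjugated row, which exchanges their roles.
  · have h := norm_avg_row_error_le (u := fun l => l⁻¹) (by fun_prop) (by fun_prop) d01 d11
      cinv (fun l hl => hD l hl 0 1) (fun l hl => hD l hl 1 1) hinv hε0 hs1' hr1'
    rw [avg_congr (g := fun l => l⁻¹ * P l 0 1 - l⁻¹ * (starRingEnd ℂ) (P l 1 0))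
      (fun l hl => by rw [← (row l hl).2, mul_sub]), avg_sub (by fun_prop) (by fun_prop),
      avg_inv_mul_conj (hP.diffContOnCl 1 0), avg_inv_mul_eq_deriv (hP.diffContOnCl 0 1), sub_zero] at h
    exact h
  · have h := norm_avg_row_error_le (u := fun l => l⁻¹) (s := fun l => P l 1 1)
      (r := fun l => P l 1 0) (x := fun l => (starRingEnd ℂ) (D l 0 1))
      (y := fun l => (starRingEnd ℂ) (D l 1 1)) (by fun_prop) (by fun_prop) (by fun_prop)
      (by fun_prop) cinv (fun l hl => by rw [RCLike.norm_conj]; exact hD l hl 0 1)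
      (fun l hl => by rw [RCLike.norm_conj]; exact hD l hl 1 1) hinv hε0 hs1 hr1
    rw [avg_congr (g := fun l => l⁻¹ * (starRingEnd ℂ) (P l 0 1) - l⁻¹ * P l 1 0)
      (fun l hl => by
        have := congrArg (starRingEnd ℂ) (row l hl).2
        simp only [map_sub, map_mul, Complex.conj_conj] at this
        rw [← this, mul_sub]), avg_sub (by fun_prop) (by fun_prop),
      avg_inv_mul_conj (hP.diffContOnCl 0 1), avg_inv_mul_eq_deriv (hP.diffContOnCl 1 0), zero_sub] at h
    rw [← norm_neg, neg_add]
    simpa [sub_eq_add_neg] using h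

/-! ### Comparison of two plus factors. -/

theorem isDiscMap_mul_adjugate {B₁ B₂ : ℂ → M2} {ρ₁ ρ₂ : ℝ} (h₁ : IsDiscMap B₁ ρ₁)
    (h₂ : IsDiscMap B₂ ρ₂) : IsDiscMap (fun l => B₂ l * (B₁ l).adjugate) (ρ₂ / ρ₁) where
  diffContOnCl i j := by
    have hd : ∀ i j, DiffContOnCl ℂ (fun l => (B₁ l).adjugate i j) (ball 0 1) := by
      intro i j
      simp only [Matrix.adjugate_fin_two]
      fin_cases i <;> fin_cases j
      · exact h₁.diffContOnCl 1 1
      · exact (h₁.diffContOnCl 0 1).neg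
      · exact (h₁.diffContOnCl 1 0).neg
      · exact h₁.diffContOnCl 0 0
    simp only [Matrix.mul_apply, Fin.sum_univ_two]
    exact (DiffContOnCl.mul' (h₂.diffContOnCl i 0) (hd 0 j)).add
      (DiffContOnCl.mul' (h₂.diffContOnCl i 1) (hd 1 j))
  det l hl := by
    rw [Matrix.det_mul, Matrix.det_adjugate, h₁.det l hl, h₂.det l hl]
    simp
  pos := div_pos h₂.pos h₁.pos
  zero := by
    rw [h₁.zero, h₂.zero, Matrix.adjugate_fin_two_of, Matrix.mul_fin_two]
    simp [div_eq_mul_inv, mul_comm]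

theorem IsDiscMap.hasDerivAt {B : ℂ → M2} {ρ : ℝ} (h : IsDiscMap B ρ) (i j : Fin 2) :
    HasDerivAt (fun l => B l i j) (deriv (fun l => B l i j) 0) 0 :=
  ((h.diffContOnCl i j).differentiableAt isOpen_ball (mem_ball_self one_pos)).hasDerivAt

/-- The normalized upper off-diagonal coefficient of order one. -/
def upperCoeff (B : ℂ → M2) : ℂ := deriv (fun l => B l 0 1) 0 / B 0 0 0

/-- The normalized lower off-diagonal coefficient of order one. -/
def lowerCoeff (B : ℂ → M2) : ℂ := deriv (fun l => B l 1 0) 0 * B 0 0 0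

/-- The normalization by the value at `0` is chosen so that the order-one coefficient of `B₂ B₁⁻¹`
is proportional to a difference of the two normalized coefficients. -/
theorem deriv_mul_adjugate_upper {B₁ B₂ : ℂ → M2} {ρ₁ ρ₂ : ℝ} (h₁ : IsDiscMap B₁ ρ₁)
    (h₂ : IsDiscMap B₂ ρ₂) :
    deriv (fun l => (B₂ l * (B₁ l).adjugate) 0 1) 0
      = ρ₁ * ρ₂ * (upperCoeff B₂ - upperCoeff B₁) := by
  have e : (fun l => (B₂ l * (B₁ l).adjugate) 0 1)
      = fun l => B₂ l 0 0 * -B₁ l 0 1 + B₂ l 0 1 * B₁ l 0 0 := by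
    ext l
    simp [Matrix.mul_apply, Matrix.adjugate_fin_two]
  have hρ₁ : (ρ₁ : ℂ) ≠ 0 := by exact_mod_cast h₁.pos.ne'
  have hρ₂ : (ρ₂ : ℂ) ≠ 0 := by exact_mod_cast h₂.pos.ne'
  have hd := ((h₂.hasDerivAt 0 0).mul (h₁.hasDerivAt 0 1).neg).add
    ((h₂.hasDerivAt 0 1).mul (h₁.hasDerivAt 0 0))
  rw [e]
  refine hd.deriv.trans ?_
  simp only [upperCoeff, h₁.zero, h₂.zero, Matrix.of_apply, Matrix.cons_val', Matrix.cons_val_zero,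
    Matrix.cons_val_one, Matrix.cons_val_fin_one, Pi.neg_apply]
  field_simp
  ring

theorem deriv_mul_adjugate_lower {B₁ B₂ : ℂ → M2} {ρ₁ ρ₂ : ℝ} (h₁ : IsDiscMap B₁ ρ₁)
    (h₂ : IsDiscMap B₂ ρ₂) :
    deriv (fun l => (B₂ l * (B₁ l).adjugate) 1 0) 0
      = (lowerCoeff B₂ - lowerCoeff B₁) / (ρ₁ * ρ₂) := by
  have e : (fun l => (B₂ l * (B₁ l).adjugate) 1 0)
      = fun l => B₂ l 1 0 * B₁ l 1 1 + B₂ l 1 1 * -B₁ l 1 0 := by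
    ext l
    simp [Matrix.mul_apply, Matrix.adjugate_fin_two]
  have hρ₁ : (ρ₁ : ℂ) ≠ 0 := by exact_mod_cast h₁.pos.ne'
  have hρ₂ : (ρ₂ : ℂ) ≠ 0 := by exact_mod_cast h₂.pos.ne'
  have hd := ((h₂.hasDerivAt 1 0).mul (h₁.hasDerivAt 1 1)).add
    ((h₂.hasDerivAt 1 1).mul (h₁.hasDerivAt 1 0).neg)
  rw [e]
  refine hd.deriv.trans ?_
  simp only [lowerCoeff, h₁.zero, h₂.zero, Matrix.of_apply, Matrix.cons_val', Matrix.cons_val_zero,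
    Matrix.cons_val_one, Matrix.cons_val_fin_one, Pi.neg_apply]
  field_simp
  ring

/-- The defect `D` in `B₂ᴴ J B₂ = B₁ᴴ (J + D) B₁`, for `det B₁ = 1` and `H = B₂ᴴ J B₂`. -/
def defect (B₁ H : M2) : M2 := B₁.adjugateᴴ * H * B₁.adjugate - J

theorem conjTranspose_mul_J_mul_adjugate (B₁ B₂ : M2) :
    (B₂ * B₁.adjugate)ᴴ * J * (B₂ * B₁.adjugate) = J + defect B₁ (B₂ᴴ * J * B₂) := by
  rw [defect, Matrix.conjTranspose_mul]
  simp only [Matrix.mul_assoc]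
  abel

theorem defect_self {B : M2} (h : B.det = 1) : defect B (Bᴴ * J * B) = 0 := by
  have h1 : B * B.adjugate = 1 := by rw [Matrix.mul_adjugate, h, one_smul]
  have h2 : B.adjugateᴴ * Bᴴ = 1 := by
    rw [← Matrix.conjTranspose_mul, h1, Matrix.conjTranspose_one]
  rw [defect, sub_eq_zero]
  calc B.adjugateᴴ * (Bᴴ * J * B) * B.adjugate
      = (B.adjugateᴴ * Bᴴ) * J * (B * B.adjugate) := by simp only [Matrix.mul_assoc]
    _ = J := by rw [h1, h2, Matrix.one_mul, Matrix.mul_one]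

/-- This is the stability estimate for `B₂ B₁⁻¹`; on the circle the adjugate is the inverse, and it
stays holomorphic inside. -/
theorem IsDiscMap.compare {B₁ B₂ D : ℂ → M2} {ρ₁ ρ₂ ε : ℝ} (h₁ : IsDiscMap B₁ ρ₁)
    (h₂ : IsDiscMap B₂ ρ₂)
    (hDdef : ∀ l ∈ sphere (0 : ℂ) 1, defect (B₁ l) ((B₂ l)ᴴ * J * B₂ l) = D l)
    (hD : ∀ l ∈ sphere (0 : ℂ) 1, ∀ i j, ‖D l i j‖ ≤ ε) (hε0 : 0 ≤ ε) (hε : ε ≤ 1 / 4) :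
    ‖((ρ₂ / ρ₁ - (ρ₂ / ρ₁)⁻¹ : ℝ) : ℂ) - avg (fun l => D l 0 0)‖ ≤ 8 * ε ^ 2 ∧
    ‖ρ₁ * ρ₂ * (upperCoeff B₂ - upperCoeff B₁) - avg (fun l => l⁻¹ * D l 0 1)‖ ≤ 8 * ε ^ 2 ∧
    ‖(lowerCoeff B₂ - lowerCoeff B₁) / (ρ₁ * ρ₂)
      + avg (fun l => l⁻¹ * (starRingEnd ℂ) (D l 0 1))‖ ≤ 8 * ε ^ 2 := by
  rw [← deriv_mul_adjugate_upper h₁ h₂, ← deriv_mul_adjugate_lower h₁ h₂]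
  refine (isDiscMap_mul_adjugate h₁ h₂).stability (fun l hl => ?_) hD hε0 hε
  rw [conjTranspose_mul_J_mul_adjugate, hDdef l hl]

/-- Uniqueness of the factorization, at the level of the coefficients of order at most one. -/
theorem IsDiscMap.unique {B₁ B₂ : ℂ → M2} {ρ₁ ρ₂ : ℝ} (h₁ : IsDiscMap B₁ ρ₁)
    (h₂ : IsDiscMap B₂ ρ₂)
    (h : ∀ l ∈ sphere (0 : ℂ) 1, (B₂ l)ᴴ * J * B₂ l = (B₁ l)ᴴ * J * B₁ l) :
    ρ₂ = ρ₁ ∧ upperCoeff B₂ = upperCoeff B₁ ∧ lowerCoeff B₂ = lowerCoeff B₁ := by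
  obtain ⟨h0, h1, h2⟩ := h₁.compare h₂ (D := fun _ => 0) (ε := 0)
    (fun l hl => by rw [h l hl, defect_self (h₁.det l hl)])
    (by simp) le_rfl (by norm_num)
  have hρ₁ := h₁.pos
  have hρ₂ := h₂.pos
  have hρ₁' : (ρ₁ : ℂ) ≠ 0 := by exact_mod_cast hρ₁.ne'
  have hρ₂' : (ρ₂ : ℂ) ≠ 0 := by exact_mod_cast hρ₂.ne'
  simp only [Matrix.zero_apply, mul_zero, map_zero, avg_const, sub_zero, add_zero, ne_eq,
    OfNat.ofNat_ne_zero, not_false_eq_true, zero_pow, norm_le_zero_iff, mul_eq_zero, hρ₁', hρ₂',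
    or_self, false_or, div_eq_zero_iff, or_false, sub_eq_zero] at h0 h1 h2
  refine ⟨?_, h1, h2⟩
  -- A positive number equal to its inverse is `1`.
  have h0' : ρ₂ / ρ₁ - (ρ₂ / ρ₁)⁻¹ = 0 := by exact_mod_cast h0
  field_simp at h0'
  nlinarith

/-! ### Differentiation in a real parameter and the first variation. -/

section Parameter

/-- An error of size `t²` does not affect the derivative at `0`, so `F` inherits it from `G` with no
regularity of its own assumed. -/
theorem HasDerivAt.of_norm_sub_le_sq {E : Type*} [NormedAddCommGroup E] [NormedSpace ℝ E]
    {F G : ℝ → E} {g : E} {C : ℝ} (hG : HasDerivAt G g 0)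
    (h : ∀ᶠ t in 𝓝 (0 : ℝ), ‖F t - G t‖ ≤ C * t ^ 2) : HasDerivAt F g 0 := by
  have h1 : HasFDerivAt (fun t => F t - G t) (0 : ℝ →L[ℝ] E) 0 := by
    refine Asymptotics.IsBigO.hasFDerivAt (n := 2) (Asymptotics.IsBigO.of_bound C ?_) one_lt_two
    filter_upwards [h] with t ht
    simpa using ht
  have h2 := h1.hasDerivAt.add hG
  simp only [zero_apply, zero_add] at h2
  exact h2.congr_of_eventuallyEq (Filter.Eventually.of_forall fun t => by simp)

variable {f f' : ℝ → ℂ → ℂ}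

theorem exists_norm_le_of_continuousOn_sphere
    (hc : ContinuousOn (fun p : ℝ × ℂ => f' p.1 p.2) (Set.univ ×ˢ sphere 0 1)) :
    ∃ K : ℝ, 0 ≤ K ∧ ∀ t ∈ Set.Icc (-1 : ℝ) 1, ∀ l ∈ sphere (0 : ℂ) 1, ‖f' t l‖ ≤ K := by
  obtain ⟨K, hK⟩ := (isCompact_Icc.prod (isCompact_sphere (0 : ℂ) 1)).exists_bound_of_continuousOn
    (hc.mono (Set.prod_mono (Set.subset_univ (Set.Icc (-1 : ℝ) 1)) le_rfl))
  exact ⟨max K 0, le_max_right _ _, fun t ht l hl => (hK (t, l) ⟨ht, hl⟩).trans (le_max_left _ _)⟩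

theorem exists_norm_sub_le_of_hasDerivAt
    (hd : ∀ l ∈ sphere (0 : ℂ) 1, ∀ t, HasDerivAt (fun t => f t l) (f' t l) t)
    (hc : ContinuousOn (fun p : ℝ × ℂ => f' p.1 p.2) (Set.univ ×ˢ sphere 0 1)) :
    ∃ K : ℝ, 0 ≤ K ∧ ∀ t ∈ Set.Icc (-1 : ℝ) 1, ∀ l ∈ sphere (0 : ℂ) 1,
      ‖f t l - f 0 l‖ ≤ K * |t| := by
  obtain ⟨K, hK0, hK⟩ := exists_norm_le_of_continuousOn_sphere hc
  refine ⟨K, hK0, fun t ht l hl => ?_⟩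
  have := (convex_Icc (-1 : ℝ) 1).norm_image_sub_le_of_norm_hasDerivWithin_le
    (fun s hs => (hd l hl s).hasDerivWithinAt) (fun s hs => hK s hs l hl)
    (show (0 : ℝ) ∈ Set.Icc (-1 : ℝ) 1 by simp) ht
  simpa using this

theorem hasDerivAt_avg (hf : ∀ t, ContinuousOn (f t) (sphere 0 1))
    (hd : ∀ l ∈ sphere (0 : ℂ) 1, ∀ t, HasDerivAt (fun t => f t l) (f' t l) t)
    (hc : ContinuousOn (fun p : ℝ × ℂ => f' p.1 p.2) (Set.univ ×ˢ sphere 0 1)) :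
    HasDerivAt (fun t => avg (f t)) (avg (f' 0)) 0 := by
  obtain ⟨K, hK0, hK⟩ := exists_norm_le_of_continuousOn_sphere hc
  have hmem : ∀ θ : ℝ, circleMap 0 1 θ ∈ sphere (0 : ℂ) 1 := fun θ =>
    circleMap_mem_sphere 0 zero_le_one θ
  have hcf : ∀ t, Continuous (fun θ => f t (circleMap 0 1 θ)) := fun t =>
    (hf t).comp_continuous (continuous_circleMap 0 1) hmem
  have hcf' : Continuous (fun θ => f' 0 (circleMap 0 1 θ)) :=
    hc.comp_continuous (f := fun θ : ℝ => ((0 : ℝ), circleMap 0 1 θ)) (by fun_prop)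
      (fun θ => ⟨Set.mem_univ _, hmem θ⟩)
  have := (intervalIntegral.hasDerivAt_integral_of_dominated_loc_of_deriv_le
    (F := fun t θ => f t (circleMap 0 1 θ)) (F' := fun t θ => f' t (circleMap 0 1 θ))
    (x₀ := (0 : ℝ)) (s := Set.Icc (-1) 1) (a := 0) (b := 2 * π) (bound := fun _ => K)
    (μ := MeasureTheory.volume)
    (Icc_mem_nhds (by norm_num) (by norm_num))
    (Filter.Eventually.of_forall fun t => (hcf t).aestronglyMeasurable)
    ((hcf 0).intervalIntegrable _ _) hcf'.aestronglyMeasurable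
    (Filter.Eventually.of_forall fun θ _ t ht => hK t ht _ (hmem θ))
    intervalIntegrable_const
    (Filter.Eventually.of_forall fun θ _ t _ => hd _ (hmem θ) t)).2
  simp only [avg, circleAverage_def]
  exact this.const_smul ((2 * π)⁻¹ : ℝ)

end Parameter

/-- First variation of the factorization `B tᴴ J B t = H t` along a curve. -/
theorem hasDerivAt_factorization {B H H' : ℝ → ℂ → M2} {ρ : ℝ → ℝ}
    (hB : ∀ᶠ t in 𝓝 (0 : ℝ), IsDiscMap (B t) (ρ t))
    (hH : ∀ᶠ t in 𝓝 (0 : ℝ), ∀ l ∈ sphere (0 : ℂ) 1, (B t l)ᴴ * J * B t l = H t l)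
    (hd : ∀ i j, ∀ l ∈ sphere (0 : ℂ) 1, ∀ t,
      HasDerivAt (fun t => H t l i j) (H' t l i j) t)
    (hc : ∀ i j, ContinuousOn (fun p : ℝ × ℂ => H p.1 p.2 i j) (Set.univ ×ˢ sphere 0 1))
    (hc' : ∀ i j, ContinuousOn (fun p : ℝ × ℂ => H' p.1 p.2 i j) (Set.univ ×ˢ sphere 0 1))
    {D' : ℂ → M2} (hD' : ∀ l, D' l = (B 0 l).adjugateᴴ * H' 0 l * (B 0 l).adjugate) :
    HasDerivAt (fun t => Real.log (ρ t)) ((avg fun l => D' l 0 0).re / 2) 0 ∧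
    HasDerivAt (fun t => upperCoeff (B t)) ((avg fun l => l⁻¹ * D' l 0 1) / (ρ 0) ^ 2) 0 ∧
    HasDerivAt (fun t => lowerCoeff (B t))
      (-(avg fun l => l⁻¹ * (starRingEnd ℂ) (D' l 0 1)) * (ρ 0) ^ 2) 0 := by
  have hB0 := hB.self_of_nhds
  set A : ℂ → M2 := fun l => (B 0 l).adjugate with hA
  set D : ℝ → ℂ → M2 := fun t l => defect (B 0 l) (H t l) with hDdef
  set E : ℝ → ℂ → M2 := fun t l => (A l)ᴴ * H' t l * A l with hEdef
  have hAc : ∀ i j, ContinuousOn (fun l => A l i j) (sphere 0 1) := by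
    intro i j
    simp only [hA, Matrix.adjugate_fin_two]
    fin_cases i <;> fin_cases j
    · exact hB0.continuousOn 1 1
    · exact (hB0.continuousOn 0 1).neg
    · exact (hB0.continuousOn 1 0).neg
    · exact hB0.continuousOn 0 0
  have hAc2 : ∀ i j, ContinuousOn (fun p : ℝ × ℂ => A p.2 i j) (Set.univ ×ˢ sphere 0 1) :=
    fun i j => (hAc i j).comp continuousOn_snd fun p hp => hp.2
  have hDd : ∀ i j, ∀ l ∈ sphere (0 : ℂ) 1, ∀ t,
      HasDerivAt (fun t => D t l i j) (E t l i j) t := by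
    intro i j l hl t
    simp only [hDdef, hEdef, defect, Matrix.sub_apply]
    change HasDerivAt (fun t => ((A l)ᴴ * H t l * A l) i j - J i j) _ t
    simp only [conjTranspose_mul_mul_apply]
    refine HasDerivAt.sub_const _ (HasDerivAt.fun_sum fun k _ => HasDerivAt.fun_sum fun m _ => ?_)
    exact ((hd m k l hl t).const_mul _).mul_const _
  have hDc2 : ∀ i j, ContinuousOn (fun p : ℝ × ℂ => D p.1 p.2 i j) (Set.univ ×ˢ sphere 0 1) := by
    intro i j
    simp only [hDdef, defect, Matrix.sub_apply]
    change ContinuousOn (fun p : ℝ × ℂ => ((A p.2)ᴴ * H p.1 p.2 * A p.2) i j - J i j) _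
    simp only [conjTranspose_mul_mul_apply]
    refine ContinuousOn.sub (continuousOn_finsetSum _ fun k _ => continuousOn_finsetSum _
      fun m _ => ?_) continuousOn_const
    exact ((Complex.continuous_conj.comp_continuousOn (hAc2 m i)).mul (hc m k)).mul (hAc2 k j)
  have hEc2 : ∀ i j, ContinuousOn (fun p : ℝ × ℂ => E p.1 p.2 i j) (Set.univ ×ˢ sphere 0 1) := by
    intro i j
    simp only [hEdef, conjTranspose_mul_mul_apply]
    refine continuousOn_finsetSum _ fun k _ => continuousOn_finsetSum _ fun m _ => ?_
    exact ((Complex.continuous_conj.comp_continuousOn (hAc2 m i)).mul (hc' m k)).mul (hAc2 k j)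
  have slice : ∀ {g : ℝ → ℂ → ℂ} (t : ℝ),
      ContinuousOn (fun p : ℝ × ℂ => g p.1 p.2) (Set.univ ×ˢ sphere 0 1) →
      ContinuousOn (g t) (sphere 0 1) := fun t hg =>
    hg.comp (f := fun l : ℂ => (t, l)) (by fun_prop) fun l hl => ⟨Set.mem_univ _, hl⟩
  have hDc : ∀ t i j, ContinuousOn (fun l => D t l i j) (sphere 0 1) := fun t i j =>
    slice (g := fun t l => D t l i j) t (hDc2 i j)
  have hE0 : D' = E 0 := funext hD'
  have hD0 : ∀ l ∈ sphere (0 : ℂ) 1, D 0 l = 0 := fun l hl => by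
    simp only [hDdef]
    rw [← hH.self_of_nhds l hl, defect_self (hB0.det l hl)]
  -- The defect vanishes at `t = 0` and is therefore `O(t)`, uniformly on the circle; summing the
  -- constants of the four entries gives a common one.
  obtain ⟨K, hK0, hK⟩ : ∃ K : ℝ, 0 ≤ K ∧ ∀ t ∈ Set.Icc (-1 : ℝ) 1, ∀ l ∈ sphere (0 : ℂ) 1,
      ∀ i j, ‖D t l i j‖ ≤ K * |t| := by
    choose K hK0 hK using fun i j => exists_norm_sub_le_of_hasDerivAt (hDd i j) (hEc2 i j)
    refine ⟨∑ i, ∑ j, K i j, Finset.sum_nonneg fun i _ => Finset.sum_nonneg fun j _ => hK0 i j, fun t ht l hl i j => ?_⟩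
    have h := hK i j t ht l hl
    rw [hD0 l hl, Matrix.zero_apply, sub_zero] at h
    refine h.trans (mul_le_mul_of_nonneg_right ?_ (abs_nonneg t))
    exact (Finset.single_le_sum (f := fun j => K i j) (fun j _ => hK0 i j) (Finset.mem_univ j)).trans
      (Finset.single_le_sum (f := fun i => ∑ j, K i j)
        (fun i _ => Finset.sum_nonneg fun j _ => hK0 i j) (Finset.mem_univ i))
  have hsmall : ∀ᶠ t in 𝓝 (0 : ℝ), t ∈ Set.Icc (-1 : ℝ) 1 ∧ K * |t| ≤ 1 / 4 := by
    refine Filter.Eventually.and (Icc_mem_nhds (by norm_num) (by norm_num)) ?_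
    have : Filter.Tendsto (fun t : ℝ => K * |t|) (𝓝 0) (𝓝 (K * |0|)) :=
      (by fun_prop : Continuous fun t : ℝ => K * |t|).tendsto 0
    rw [abs_zero, mul_zero] at this
    exact this.eventually_le_const (by norm_num)
  have hcmp : ∀ᶠ t in 𝓝 (0 : ℝ),
      ‖((ρ t / ρ 0 - (ρ t / ρ 0)⁻¹ : ℝ) : ℂ) - avg (fun l => D t l 0 0)‖ ≤ 8 * K ^ 2 * t ^ 2 ∧
      ‖ρ 0 * ρ t * (upperCoeff (B t) - upperCoeff (B 0)) - avg (fun l => l⁻¹ * D t l 0 1)‖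
        ≤ 8 * K ^ 2 * t ^ 2 ∧
      ‖(lowerCoeff (B t) - lowerCoeff (B 0)) / (ρ 0 * ρ t)
        - -avg (fun l => l⁻¹ * (starRingEnd ℂ) (D t l 0 1))‖ ≤ 8 * K ^ 2 * t ^ 2 := by
    filter_upwards [hB, hH, hsmall] with t hBt hHt ⟨ht1, ht2⟩
    have := hB0.compare hBt (D := D t) (ε := K * |t|) (fun l hl => by rw [hHt l hl])
      (hK t ht1) (by positivity) ht2
    rw [mul_pow, sq_abs, ← mul_assoc] at this
    simpa only [sub_neg_eq_add] using this
  have cinv : ContinuousOn (fun l : ℂ => l⁻¹) (sphere 0 1) :=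
    continuousOn_inv₀.mono fun l hl => ne_of_mem_sphere hl one_ne_zero
  have cinv2 : ContinuousOn (fun p : ℝ × ℂ => p.2⁻¹) (Set.univ ×ˢ sphere 0 1) :=
    cinv.comp continuousOn_snd fun p hp => hp.2
  have d1 := hasDerivAt_avg (fun t => hDc t 0 0) (hDd 0 0) (hEc2 0 0)
  have d2 := hasDerivAt_avg (f := fun t l => l⁻¹ * D t l 0 1) (f' := fun t l => l⁻¹ * E t l 0 1)
    (fun t => cinv.mul (hDc t 0 1)) (fun l hl t => (hDd 0 1 l hl t).const_mul _)
    (cinv2.mul (hEc2 0 1))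
  have d3 := hasDerivAt_avg (f := fun t l => l⁻¹ * (starRingEnd ℂ) (D t l 0 1))
    (f' := fun t l => l⁻¹ * (starRingEnd ℂ) (E t l 0 1))
    (fun t => cinv.mul (Complex.continuous_conj.comp_continuousOn (hDc t 0 1)))
    (fun l hl t => (hDd 0 1 l hl t).star.const_mul _)
    (cinv2.mul (Complex.continuous_conj.comp_continuousOn (hEc2 0 1)))
  have f1 := HasDerivAt.of_norm_sub_le_sq d1 (hcmp.mono fun t h => h.1)
  have f2 := HasDerivAt.of_norm_sub_le_sq d2 (hcmp.mono fun t h => h.2.1)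
  have f3 := HasDerivAt.of_norm_sub_le_sq d3.neg (hcmp.mono fun t h => h.2.2)
  rw [hE0]
  have hρ0 := hB0.pos
  have hlog : HasDerivAt (fun t => Real.log (ρ t)) ((avg fun l => E 0 l 0 0).re / 2) 0 := by
    have f1' : HasDerivAt (fun t => ρ t / ρ 0 - (ρ t / ρ 0)⁻¹) (avg fun l => E 0 l 0 0).re 0 := by
      simpa [Function.comp_def] using Complex.reCLM.hasFDerivAt.comp_hasDerivAt (0 : ℝ) f1
    -- For `x > 0`, `log x = arsinh ((x - x⁻¹) / 2)`, and `arsinh` has derivative `1` at `0`.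
    have f4 := ((f1'.div_const 2).arsinh).const_add (Real.log (ρ 0))
    rw [div_self hρ0.ne', inv_one, sub_self, zero_div] at f4
    simp only [ne_eq, OfNat.ofNat_ne_zero, not_false_eq_true, zero_pow, add_zero, Real.sqrt_one,
      inv_one, one_smul] at f4
    refine f4.congr_of_eventuallyEq (hB.mono fun t ht => ?_)
    have hx : 0 < ρ t / ρ 0 := div_pos ht.pos hρ0
    simp only
    rw [← Real.sinh_log hx, Real.arsinh_sinh, Real.log_div ht.pos.ne' hρ0.ne']
    ring
  have hρd : HasDerivAt (fun t => (ρ t : ℂ))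
      ((ρ 0 * ((avg fun l => E 0 l 0 0).re / 2) : ℝ) : ℂ) 0 := by
    have := hlog.exp.congr_of_eventuallyEq (f₁ := ρ)
      (hB.mono fun t ht => (Real.exp_log ht.pos).symm)
    rw [Real.exp_log hρ0] at this
    exact this.ofReal_comp
  have hρ0' : (ρ 0 : ℂ) ≠ 0 := by exact_mod_cast hρ0.ne'
  refine ⟨hlog, ?_, ?_⟩
  -- The differentiated numerator vanishes at `t = 0`, so the derivative of `ρ` does not contribute.
  · have := (f2.div (hρd.const_mul (ρ 0 : ℂ)) (mul_ne_zero hρ0' hρ0')).const_add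
      (upperCoeff (B 0))
    simp only [sub_self, mul_zero, zero_mul, sub_zero] at this
    refine (this.congr_of_eventuallyEq (hB.mono fun t ht => ?_)).congr_deriv ?_
    · have : (ρ t : ℂ) ≠ 0 := by exact_mod_cast ht.pos.ne'
      simp only [Pi.div_apply]
      field_simp
      ring
    · field_simp
  · have := (f3.mul (hρd.const_mul (ρ 0 : ℂ))).const_add (lowerCoeff (B 0))
    simp only [sub_self, zero_div, zero_mul, add_zero] at this
    refine (this.congr_of_eventuallyEq (hB.mono fun t ht => ?_)).congr_deriv ?_
    · have : (ρ t : ℂ) ≠ 0 := by exact_mod_cast ht.pos.ne'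
      simp only [Pi.mul_apply]
      field_simp
      ring
    · ring

/-! ### The first variation along the potential. -/

/-- The coefficient matrix of the potential in the coordinate `ζ = log z`, where `c = z ^ 4`. -/
def potential (c l : ℂ) : M2 := !![0, l⁻¹ * c; l⁻¹, 0]

/-- Since `B⁻¹ = B.adjugate`, the outer factors cancel against those of `Bᴴ J B`, and only the
conjugated potential `B X B⁻¹` remains. -/
theorem conjugate_variation {B X : M2} (hB : B.det = 1) (e : ℂ) :
    B.adjugateᴴ * (e • (Bᴴ * J * B * X) + (starRingEnd ℂ) e • (Xᴴ * (Bᴴ * J * B))) * B.adjugate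
      = e • (J * (B * X * B.adjugate)) + (starRingEnd ℂ) e • ((B * X * B.adjugate)ᴴ * J) := by
  have h1 : B * B.adjugate = 1 := by rw [Matrix.mul_adjugate, hB, one_smul]
  have h2 : B.adjugateᴴ * Bᴴ = 1 := by
    rw [← Matrix.conjTranspose_mul, h1, Matrix.conjTranspose_one]
  rw [Matrix.mul_add, Matrix.add_mul]
  congr 1
  · rw [Matrix.mul_smul, Matrix.smul_mul]
    congr 1
    calc B.adjugateᴴ * (Bᴴ * J * B * X) * B.adjugate
        = (B.adjugateᴴ * Bᴴ) * (J * (B * X * B.adjugate)) := by simp only [Matrix.mul_assoc]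
      _ = _ := by rw [h2, Matrix.one_mul]
  · rw [Matrix.mul_smul, Matrix.smul_mul]
    congr 1
    calc B.adjugateᴴ * (Xᴴ * (Bᴴ * J * B)) * B.adjugate
        = (B.adjugateᴴ * Xᴴ * Bᴴ) * J * (B * B.adjugate) := by simp only [Matrix.mul_assoc]
      _ = _ := by
        rw [h1, Matrix.mul_one, Matrix.conjTranspose_mul, Matrix.conjTranspose_mul,
          ← Matrix.mul_assoc]

theorem conjugate_potential (B : M2) (c l : ℂ) :
    B * potential c l * B.adjugate
      = !![l⁻¹ * (B 0 1 * B 1 1 - c * (B 0 0 * B 1 0)), l⁻¹ * (c * (B 0 0 * B 0 0) - B 0 1 * B 0 1);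
          l⁻¹ * (B 1 1 * B 1 1 - c * (B 1 0 * B 1 0)),
          l⁻¹ * (c * (B 0 0 * B 1 0) - B 0 1 * B 1 1)] := by
  rw [Matrix.adjugate_fin_two, potential]
  apply matrix_ext_two <;> simp [Matrix.mul_apply] <;> ring

/-- The averages that govern the variation of the factorization along the potential. -/
theorem IsDiscMap.avg_variation {B : ℂ → M2} {ρ : ℝ} (hB : IsDiscMap B ρ) (c : ℂ) :
    ∃ κ₁ κ₂ : ℂ, ∀ (e : ℂ) (D' : ℂ → M2),
      (∀ l ∈ sphere (0 : ℂ) 1, D' l = (B l).adjugateᴴ *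
        (e • ((B l)ᴴ * J * B l * potential c l)
          + (starRingEnd ℂ) e • ((potential c l)ᴴ * ((B l)ᴴ * J * B l))) * (B l).adjugate) →
      (avg fun l => D' l 0 0).re = 2 * (e * (upperCoeff B - c * lowerCoeff B)).re ∧
      (avg fun l => l⁻¹ * D' l 0 1) = e * κ₁ - (starRingEnd ℂ) e * ((ρ : ℂ) ^ 2)⁻¹ ∧
      (avg fun l => l⁻¹ * (starRingEnd ℂ) (D' l 0 1))
        = (starRingEnd ℂ) e * ((starRingEnd ℂ) c * (ρ : ℂ) ^ 2) - e * κ₂ := by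
  have d := hB.diffContOnCl
  have hρ : (ρ : ℂ) ≠ 0 := by exact_mod_cast hB.pos.ne'
  set q00 : ℂ → ℂ := fun l => B l 0 1 * B l 1 1 - c * (B l 0 0 * B l 1 0) with hq00
  set q01 : ℂ → ℂ := fun l => c * (B l 0 0 * B l 0 0) - B l 0 1 * B l 0 1 with hq01
  set q10 : ℂ → ℂ := fun l => B l 1 1 * B l 1 1 - c * (B l 1 0 * B l 1 0) with hq10
  have m : ∀ i j i' j', DiffContOnCl ℂ (fun l => B l i j * B l i' j') (ball 0 1) :=
    fun i j i' j' => DiffContOnCl.mul' (d i j) (d i' j')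
  have d00 : DiffContOnCl ℂ q00 (ball 0 1) :=
    (m 0 1 1 1).sub ((m 0 0 1 0).const_smul c)
  have d01 : DiffContOnCl ℂ q01 (ball 0 1) :=
    ((m 0 0 0 0).const_smul c).sub (m 0 1 0 1)
  have d10 : DiffContOnCl ℂ q10 (ball 0 1) :=
    (m 1 1 1 1).sub ((m 1 0 1 0).const_smul c)
  have c00 := continuousOn_sphere_of_diffContOnCl d00
  have c01 := continuousOn_sphere_of_diffContOnCl d01
  have c10 := continuousOn_sphere_of_diffContOnCl d10
  have cinv : ContinuousOn (fun l : ℂ => l⁻¹) (sphere 0 1) :=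
    continuousOn_inv₀.mono fun l hl => ne_of_mem_sphere hl one_ne_zero
  have hderiv : deriv q00 0 = upperCoeff B - c * lowerCoeff B := by
    have h := ((hB.hasDerivAt 0 1).mul (hB.hasDerivAt 1 1)).sub
      (((hB.hasDerivAt 0 0).mul (hB.hasDerivAt 1 0)).const_mul c)
    refine h.deriv.trans ?_
    simp only [upperCoeff, lowerCoeff, hB.zero, Matrix.of_apply, Matrix.cons_val',
      Matrix.cons_val_zero, Matrix.cons_val_one, Matrix.cons_val_fin_one]
    field_simp
    ring
  -- On the circle both powers of `λ` cancel in the conjugated term, so its average is the conjugate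
  -- of a value at `0` and is known explicitly.
  have cancel : ∀ g : ℂ → ℂ, ∀ l ∈ sphere (0 : ℂ) 1,
      l⁻¹ * (starRingEnd ℂ) (l⁻¹ * g l) = (starRingEnd ℂ) (g l) := fun g l hl => by
    have h0 : l ≠ 0 := ne_of_mem_sphere hl one_ne_zero
    rw [map_mul, map_inv₀, conj_eq_inv_of_mem_sphere hl, inv_inv, ← mul_assoc,
      inv_mul_cancel₀ h0, one_mul]
  have z01 : q01 0 = c * (ρ : ℂ) ^ 2 := by simp [hq01, hB.zero, sq]
  have z10 : q10 0 = ((ρ : ℂ) ^ 2)⁻¹ := by simp [hq10, hB.zero, sq]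
  -- These are Taylor coefficients of order two at `0`. They stay unevaluated: the rotational
  -- symmetry removes them later.
  refine ⟨avg fun l => l⁻¹ * (l⁻¹ * q01 l), avg fun l => l⁻¹ * (l⁻¹ * q10 l), fun e D' hD' => ?_⟩
  have hD : ∀ l ∈ sphere (0 : ℂ) 1,
      D' l 0 0 = e * (l⁻¹ * q00 l) + (starRingEnd ℂ) (e * (l⁻¹ * q00 l)) ∧
      D' l 0 1 = e * (l⁻¹ * q01 l) - (starRingEnd ℂ) e * (starRingEnd ℂ) (l⁻¹ * q10 l) := by
    intro l hl
    rw [hD' l hl, conjugate_variation (hB.det l hl), conjugate_potential]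
    constructor
    · simp [J, Matrix.mul_apply, hq00]
    · simp [J, Matrix.mul_apply, hq01, hq10]
      ring
  refine ⟨?_, ?_, ?_⟩
  · rw [avg_congr fun l hl => (hD l hl).1, avg_add (by fun_prop) (by fun_prop),
      avg_conj (by fun_prop), avg_const_mul, avg_inv_mul_eq_deriv d00, hderiv, Complex.add_re,
      Complex.conj_re]
    ring
  · rw [avg_congr (g := fun l => e * (l⁻¹ * (l⁻¹ * q01 l))
        - (starRingEnd ℂ) e * (starRingEnd ℂ) (q10 l)) (fun l hl => by
        rw [(hD l hl).2, ← cancel q10 l hl]; ring), avg_sub (by fun_prop) (by fun_prop),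
      avg_const_mul, avg_const_mul, avg_conj c10, avg_eq_apply_zero d10, z10]
    simp
  · rw [avg_congr (g := fun l => (starRingEnd ℂ) e * (starRingEnd ℂ) (q01 l)
        - e * (l⁻¹ * (l⁻¹ * q10 l))) (fun l hl => by
        rw [(hD l hl).2, ← cancel q01 l hl]; simp; ring), avg_sub (by fun_prop) (by fun_prop),
      avg_const_mul, avg_const_mul, avg_conj c01, avg_eq_apply_zero d01, z01]
    simp

/-! ### Entire series dominated by the exponential. -/

section EntireSeries

/-- The power series with coefficients `c`. -/
def series (c : ℕ → ℂ) (u : ℂ) : ℂ := ∑' j, c j * u ^ j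

/-- The coefficients of the derivative. -/
def shiftCoeff (c : ℕ → ℂ) (j : ℕ) : ℂ := (j + 1) * c (j + 1)

/-- Coefficients bounded by those of the exponential series. -/
def ExpBounded (c : ℕ → ℂ) : Prop := ∀ j, ‖c j‖ ≤ ((Nat.factorial j : ℝ))⁻¹

/-- As `(j + 1) / (j + 1)! = 1 / j!`, the bound survives differentiation and serves all derivatives
at once. -/
theorem ExpBounded.shiftCoeff {c : ℕ → ℂ} (hc : ExpBounded c) : ExpBounded (shiftCoeff c) := by
  intro j
  have h := hc (j + 1)
  have hn : ‖((j : ℂ) + 1)‖ = (j : ℝ) + 1 := by exact_mod_cast Complex.norm_natCast (j + 1)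
  rw [SmythDPW.shiftCoeff, norm_mul, hn]
  rw [Nat.factorial_succ] at h
  push_cast at h
  calc ((j : ℝ) + 1) * ‖c (j + 1)‖ ≤ ((j : ℝ) + 1) * (((j : ℝ) + 1) * (Nat.factorial j : ℝ))⁻¹ := by
        gcongr
    _ = _ := by
        have : (j : ℝ) + 1 ≠ 0 := by positivity
        field_simp

theorem ExpBounded.summable {c : ℕ → ℂ} (hc : ExpBounded c) (u : ℂ) :
    Summable fun j => c j * u ^ j := by
  refine Summable.of_norm_bounded (Real.summable_pow_div_factorial ‖u‖) fun j => ?_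
  rw [norm_mul, norm_pow, div_eq_inv_mul]
  exact mul_le_mul_of_nonneg_right (hc j) (by positivity)

theorem ExpBounded.hasDerivAt {c : ℕ → ℂ} (hc : ExpBounded c) (u : ℂ) :
    HasDerivAt (series c) (series (SmythDPW.shiftCoeff c) u) u := by
  have hmem : u ∈ ball (0 : ℂ) (‖u‖ + 1) := by simp
  set R := ‖u‖ + 1 with hR
  have hR0 : 0 ≤ R := by positivity
  have hs : Summable fun j : ℕ => (j : ℝ) * ‖c j‖ * R ^ (j - 1) := by
    rw [← summable_nat_add_iff 1]
    refine Summable.of_norm_bounded (Real.summable_pow_div_factorial R) fun j => ?_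
    have h := hc.shiftCoeff j
    have hn : ‖((j : ℂ) + 1)‖ = (j : ℝ) + 1 := by exact_mod_cast Complex.norm_natCast (j + 1)
    rw [SmythDPW.shiftCoeff, norm_mul, hn] at h
    rw [Real.norm_of_nonneg (by positivity), div_eq_inv_mul]
    push_cast
    exact mul_le_mul_of_nonneg_right h (by positivity)
  have key := hasDerivAt_tsum_of_isPreconnected (t := ball (0 : ℂ) R) hs isOpen_ball
    (convex_ball _ _).isPreconnected
    (g := fun j y => c j * y ^ j) (g' := fun j y => c j * (j * y ^ (j - 1)))
    (fun j y _ => (hasDerivAt_pow j y).const_mul (c j))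
    (fun j y hy => by
      rw [norm_mul, norm_mul, norm_pow, Complex.norm_natCast]
      have : ‖y‖ ≤ R := (mem_ball_zero_iff.1 hy).le
      calc ‖c j‖ * (j * ‖y‖ ^ (j - 1)) ≤ ‖c j‖ * (j * R ^ (j - 1)) := by gcongr
        _ = _ := by ring)
    hmem (hc.summable u) hmem
  refine key.congr_deriv ?_
  have hsum : Summable fun j : ℕ => c j * (j * u ^ (j - 1)) := by
    rw [← summable_nat_add_iff 1]
    refine (hc.shiftCoeff.summable u).congr fun j => ?_
    simp [SmythDPW.shiftCoeff]
    ring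
  rw [hsum.tsum_eq_zero_add, series]
  simp only [Nat.cast_zero, zero_mul, mul_zero, zero_add]
  refine tsum_congr fun j => ?_
  simp [SmythDPW.shiftCoeff]
  ring

theorem ExpBounded.continuous {c : ℕ → ℂ} (hc : ExpBounded c) : Continuous (series c) :=
  continuous_iff_continuousAt.2 fun u => (hc.hasDerivAt u).continuousAt

theorem series_zero (c : ℕ → ℂ) : series c 0 = c 0 := by
  rw [series, tsum_eq_single 0]
  · simp
  · intro j hj
    simp [hj]

theorem ExpBounded.summable_natCast_mul {c : ℕ → ℂ} (hc : ExpBounded c) (u : ℂ) :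
    Summable fun j : ℕ => (j : ℂ) * c j * u ^ j := by
  rw [← summable_nat_add_iff 1]
  refine ((hc.shiftCoeff.summable u).mul_left u).congr fun j => ?_
  simp [SmythDPW.shiftCoeff]
  ring

theorem ExpBounded.mul_series_shiftCoeff {c : ℕ → ℂ} (hc : ExpBounded c) (u : ℂ) :
    u * series (SmythDPW.shiftCoeff c) u = ∑' j : ℕ, j * c j * u ^ j := by
  rw [(hc.summable_natCast_mul u).tsum_eq_zero_add, series, ← tsum_mul_left]
  simp only [Nat.cast_zero, zero_mul, zero_add]
  refine tsum_congr fun j => ?_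
  simp [SmythDPW.shiftCoeff]
  ring

/-- The operator `u ∂² + ∂` on power series. -/
theorem ExpBounded.bessel {c d : ℕ → ℂ} (hc : ExpBounded c)
    (h : ∀ j : ℕ, (j + 1) ^ 2 * c (j + 1) = d j) (u : ℂ) :
    u * series (SmythDPW.shiftCoeff (SmythDPW.shiftCoeff c)) u + series (SmythDPW.shiftCoeff c) u
      = series d u := by
  rw [hc.shiftCoeff.mul_series_shiftCoeff, series,
    ← (hc.shiftCoeff.summable_natCast_mul u).tsum_add (hc.shiftCoeff.summable u)]
  refine tsum_congr fun j => ?_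
  rw [← h j, SmythDPW.shiftCoeff]
  ring

end EntireSeries

/-! ### The canonical solution in the coordinate `ζ = log z`. -/

/-- Coefficients of the Bessel series `∑ u ^ j / (j!) ^ 2`. -/
def besselCoeff (j : ℕ) : ℂ := ((Nat.factorial j : ℂ) ^ 2)⁻¹

/-- Coefficients of the logarithmic companion series. -/
def companionCoeff (j : ℕ) : ℂ := ((harmonic j : ℚ) : ℂ) * ((Nat.factorial j : ℂ) ^ 2)⁻¹

theorem expBounded_besselCoeff : ExpBounded besselCoeff := by
  intro j
  have : (1 : ℝ) ≤ Nat.factorial j := by exact_mod_cast Nat.one_le_iff_ne_zero.2 j.factorial_ne_zero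
  simp only [besselCoeff, norm_inv, norm_pow, Complex.norm_natCast]
  gcongr
  nlinarith

/-- Crude but sufficient: one of the two factorials in the companion series absorbs the harmonic
number. -/
theorem harmonic_le_factorial (j : ℕ) : (harmonic j : ℚ) ≤ Nat.factorial j := by
  refine le_trans ?_ (Nat.cast_le.2 j.self_le_factorial)
  rw [harmonic]
  calc ∑ i ∈ Finset.range j, ((↑(i + 1) : ℚ))⁻¹ ≤ ∑ i ∈ Finset.range j, (1 : ℚ) := by
        refine Finset.sum_le_sum fun i _ => inv_le_one_of_one_le₀ ?_
        exact_mod_cast Nat.succ_le_succ (Nat.zero_le i)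
    _ = j := by simp

theorem expBounded_companionCoeff : ExpBounded companionCoeff := by
  intro j
  have h1 : (0 : ℝ) < Nat.factorial j := by exact_mod_cast j.factorial_pos
  have h2 : ((harmonic j : ℚ) : ℝ) ≤ Nat.factorial j := by exact_mod_cast harmonic_le_factorial j
  have h3 : (0 : ℝ) ≤ ((harmonic j : ℚ) : ℝ) := by
    have : (0 : ℚ) ≤ harmonic j := Finset.sum_nonneg fun i _ => by positivity
    exact_mod_cast this
  have h4 : ‖((harmonic j : ℚ) : ℂ)‖ = ((harmonic j : ℚ) : ℝ) := by
    rw [← Complex.ofReal_ratCast, Complex.norm_of_nonneg h3]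
  simp only [companionCoeff, norm_mul, norm_inv, norm_pow, Complex.norm_natCast, h4]
  calc ((harmonic j : ℚ) : ℝ) * ((Nat.factorial j : ℝ) ^ 2)⁻¹
      ≤ (Nat.factorial j : ℝ) * ((Nat.factorial j : ℝ) ^ 2)⁻¹ := by gcongr
    _ = _ := by field_simp

theorem bessel_equation (u : ℂ) :
    u * series (shiftCoeff (shiftCoeff besselCoeff)) u + series (shiftCoeff besselCoeff) u
      = series besselCoeff u := by
  refine expBounded_besselCoeff.bessel (fun j => ?_) u
  have h1 : ((j : ℂ) + 1) ≠ 0 := by exact_mod_cast j.succ_ne_zero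
  rw [besselCoeff, besselCoeff, Nat.factorial_succ]
  push_cast
  field_simp

/-- The source term comes from `H_{j+1} - H_j = 1 / (j + 1)`. It cancels what the derivative of the
logarithm contributes to the second row of the frame. -/
theorem companion_equation (u : ℂ) :
    u * series (shiftCoeff (shiftCoeff companionCoeff)) u + series (shiftCoeff companionCoeff) u
      = series companionCoeff u + series (shiftCoeff besselCoeff) u := by
  rw [expBounded_companionCoeff.bessel (d := companionCoeff + shiftCoeff besselCoeff)
    (fun j => ?_) u, series, series, series,
    ← (expBounded_companionCoeff.summable u).tsum_add (expBounded_besselCoeff.shiftCoeff.summable u)]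
  · refine tsum_congr fun j => ?_
    rw [Pi.add_apply, add_mul]
  · have h1 : ((j : ℂ) + 1) ≠ 0 := by exact_mod_cast j.succ_ne_zero
    have h2 : (Nat.factorial j : ℂ) ≠ 0 := by exact_mod_cast j.factorial_ne_zero
    rw [Pi.add_apply, shiftCoeff, companionCoeff, companionCoeff, besselCoeff, Nat.factorial_succ,
      harmonic_succ]
    push_cast
    field_simp

/-- The argument of the Bessel series in the coordinate `ζ = log z`. -/
def besselArg (ζ l : ℂ) : ℂ := l⁻¹ ^ 2 * Complex.exp (4 * ζ) / 16

/-- The logarithm-free factor of the canonical solution in the coordinate `ζ = log z`. -/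
def core (ζ l : ℂ) : M2 :=
  !![series besselCoeff (besselArg ζ l),
      4 * l * (besselArg ζ l * series (shiftCoeff besselCoeff) (besselArg ζ l));
    -(1 / 2) * l⁻¹ * series companionCoeff (besselArg ζ l),
      series besselCoeff (besselArg ζ l)
        - 2 * (besselArg ζ l * series (shiftCoeff companionCoeff) (besselArg ζ l))]

/-- The logarithmic factor of the canonical solution in the coordinate `ζ = log z`. -/
def logFactor (ζ l : ℂ) : M2 := !![1, 0; l⁻¹ * (ζ - Real.log 2), 1]

/-- The canonical solution in the coordinate `ζ = log z`. -/
def frame (ζ l : ℂ) : M2 := logFactor ζ l * core ζ l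

theorem frame_apply (ζ l : ℂ) (j : Fin 2) :
    frame ζ l 0 j = core ζ l 0 j ∧
      frame ζ l 1 j = l⁻¹ * (ζ - Real.log 2) * core ζ l 0 j + core ζ l 1 j := by
  simp [frame, logFactor, Matrix.mul_apply]

theorem y0_eq_series (z l : ℂ) : y0 z l = series besselCoeff (l⁻¹ ^ 2 * z ^ 4 / 16) := by
  rw [y0, series]
  refine tsum_congr fun j => ?_
  rw [besselCoeff, div_pow, mul_pow, ← pow_mul, ← pow_mul]
  field_simp

theorem y1_eq_series (z l : ℂ) :
    y1 z l = -2 * l⁻¹ * series companionCoeff (l⁻¹ ^ 2 * z ^ 4 / 16) := by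
  rw [y1, series]
  congr 1
  refine tsum_congr fun j => ?_
  rw [companionCoeff, div_pow, mul_pow, ← pow_mul, ← pow_mul]
  field_simp

theorem hasDerivAt_series_pow {c : ℕ → ℂ} (hc : ExpBounded c) (z l : ℂ) :
    HasDerivAt (fun x => series c (l⁻¹ ^ 2 * x ^ 4 / 16))
      (series (shiftCoeff c) (l⁻¹ ^ 2 * z ^ 4 / 16) * (l⁻¹ ^ 2 * (4 * z ^ 3) / 16)) z := by
  have h : HasDerivAt (fun x : ℂ => l⁻¹ ^ 2 * x ^ 4 / 16) (l⁻¹ ^ 2 * (4 * z ^ 3) / 16) z := by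
    exact (((hasDerivAt_pow 4 z).const_mul (l⁻¹ ^ 2)).div_const 16).congr_deriv (by norm_num)
  exact (hc.hasDerivAt _).comp z h

theorem L_eq_frame {z l : ℂ} (hz : z ∈ slitPlane) : L z l = frame (Complex.log z) l := by
  have hz0 : z ≠ 0 := slitPlane_ne_zero hz
  have hexp : Complex.exp (4 * Complex.log z) = z ^ 4 := by
    rw [show (4 : ℂ) * Complex.log z = ((4 : ℕ) : ℂ) * Complex.log z by norm_num,
      Complex.exp_nat_mul, Complex.exp_log hz0]
  -- Division by a positive real does not leave the branch.
  have hlog : Complex.log (z / 2) = Complex.log z - Real.log 2 := by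
    have h := Complex.log_ofReal_mul (r := 2⁻¹) (by norm_num) hz0
    rw [div_eq_inv_mul, show (2 : ℂ)⁻¹ = ((2⁻¹ : ℝ) : ℂ) by norm_num, h, Real.log_inv]
    push_cast
    ring
  have h0 : deriv (fun x => y0 x l) z = series (shiftCoeff besselCoeff) (l⁻¹ ^ 2 * z ^ 4 / 16)
      * (l⁻¹ ^ 2 * (4 * z ^ 3) / 16) := by
    simp only [y0_eq_series]
    exact (hasDerivAt_series_pow expBounded_besselCoeff z l).deriv
  have h1 : deriv (fun x => y1 x l) z = -2 * l⁻¹ *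
      (series (shiftCoeff companionCoeff) (l⁻¹ ^ 2 * z ^ 4 / 16)
        * (l⁻¹ ^ 2 * (4 * z ^ 3) / 16)) := by
    simp only [y1_eq_series]
    exact ((hasDerivAt_series_pow expBounded_companionCoeff z l).const_mul _).deriv
  rw [L, frame, logFactor, core, besselArg, hexp, h0, h1, hlog, y0_eq_series, y1_eq_series]
  by_cases hl : l = 0
  · subst hl
    simp
  · congr 1
    apply matrix_ext_two <;>
      simp only [Matrix.of_apply, Matrix.cons_val', Matrix.cons_val_zero, Matrix.cons_val_one,
        Matrix.cons_val_fin_one]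
    · ring
    · ring
    · field_simp
      ring

theorem hasDerivAt_besselArg (ζ l : ℂ) :
    HasDerivAt (fun x => besselArg x l) (4 * besselArg ζ l) ζ := by
  have h : HasDerivAt (fun x : ℂ => 4 * x) 4 ζ := by simpa using (hasDerivAt_id ζ).const_mul 4
  have := (h.cexp.const_mul (l⁻¹ ^ 2)).div_const 16
  exact this.congr_deriv (by rw [besselArg]; ring)

/-- With `dz = z dζ` the potential becomes `λ⁻¹ (0, z⁴; 1, 0) dζ`. The first column of the equation
defines the second column of the frame; the second column reduces to the Bessel and companion
equations. -/
theorem hasDerivAt_frame {l : ℂ} (hl : l ≠ 0) (ζ : ℂ) (i j : Fin 2) :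
    HasDerivAt (fun x => frame x l i j)
      ((frame ζ l * potential (Complex.exp (4 * ζ)) l) i j) ζ := by
  have hu := hasDerivAt_besselArg ζ l
  have comp : ∀ {c : ℕ → ℂ}, ExpBounded c → HasDerivAt (fun x => series c (besselArg x l))
      (series (shiftCoeff c) (besselArg ζ l) * (4 * besselArg ζ l)) ζ := fun hc =>
    (hc.hasDerivAt _).comp ζ hu
  have b0 := comp expBounded_besselCoeff
  have b1 := comp expBounded_besselCoeff.shiftCoeff
  have k0 := comp expBounded_companionCoeff
  have k1 := comp expBounded_companionCoeff.shiftCoeff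
  have eb := bessel_equation (besselArg ζ l)
  have ek := companion_equation (besselArg ζ l)
  have hexp : Complex.exp (4 * ζ) = 16 * l ^ 2 * besselArg ζ l := by
    rw [besselArg]; field_simp
  have hlog : HasDerivAt (fun x : ℂ => l⁻¹ * (x - Real.log 2)) l⁻¹ ζ := by
    simpa using ((hasDerivAt_id ζ).sub_const (Real.log 2 : ℂ)).const_mul l⁻¹
  have r01 := (hu.mul b1).const_mul (4 * l)
  have r10 := k0.const_mul (-(1 / 2) * l⁻¹)
  have r11 := b0.sub ((hu.mul k1).const_mul 2)
  rw [potential, hexp]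
  fin_cases i <;> fin_cases j
  · refine b0.congr_of_eventuallyEq (Filter.Eventually.of_forall fun x => ?_) |>.congr_deriv ?_
    · simp [(frame_apply x l 0).1, core]
    · simp only [Fin.zero_eta, Fin.isValue, Matrix.mul_apply, Fin.sum_univ_two, (frame_apply ζ l _).1, core]
      simp
      field_simp
  · refine r01.congr_of_eventuallyEq (Filter.Eventually.of_forall fun x => ?_) |>.congr_deriv ?_
    · simp [(frame_apply x l 1).1, core]
    · simp only [Fin.zero_eta, Fin.isValue, Fin.mk_one, Matrix.mul_apply, Fin.sum_univ_two, (frame_apply ζ l _).1, core]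
      simp
      field_simp
      linear_combination 16 * besselArg ζ l * eb
  · refine ((hlog.mul b0).add r10).congr_of_eventuallyEq
      (Filter.Eventually.of_forall fun x => ?_) |>.congr_deriv ?_
    · simp [(frame_apply x l 0).2, core]
    · simp only [Fin.zero_eta, Fin.isValue, Fin.mk_one, Matrix.mul_apply, Fin.sum_univ_two, (frame_apply ζ l _).2, core]
      simp
      field_simp
      ring
  · refine ((hlog.mul r01).add r11).congr_of_eventuallyEq
      (Filter.Eventually.of_forall fun x => ?_) |>.congr_deriv ?_
    · simp [(frame_apply x l 1).2, core]
    · simp only [Fin.isValue, Fin.mk_one, Matrix.mul_apply, Fin.sum_univ_two, (frame_apply ζ l _).2, core]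
      simp
      field_simp
      linear_combination 32 * besselArg ζ l * (ζ - Complex.log 2) * eb - 16 * besselArg ζ l * ek

/-! ### The Hermitian loop. -/

/-- The Hermitian form whose upper left entry is `c`. -/
def form (c : ℝ) (l : ℂ) : M2 := !![(c : ℂ), -l; -(starRingEnd ℂ) l, 0]

/-- The Hermitian loop `-φᴴ J φ` in the coordinate `ζ = log z`. -/
def gram (a : ℝ) (ζ l : ℂ) : M2 := (frame ζ l)ᴴ * form (-a) l * frame ζ l

/-- The upper left entry of the Hermitian loop after removal of the Bessel factor. -/
def height (a : ℝ) (ζ : ℂ) : ℝ := -a - 2 * (ζ.re - Real.log 2)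

/-- The factor `λ⁻¹` of the logarithm meets the off-diagonal `-λ` of the form, so the logarithmic
factor only shifts the corner by a real number depending on `Re ζ`. The logarithmic growth as `z →
0` is thus concentrated in one scalar. -/
theorem gram_eq_core (a : ℝ) (ζ : ℂ) {l : ℂ} (hl : l ∈ sphere (0 : ℂ) 1) :
    gram a ζ l = (core ζ l)ᴴ * form (height a ζ) l * core ζ l := by
  have h0 : l ≠ 0 := ne_of_mem_sphere hl one_ne_zero
  have h : (logFactor ζ l)ᴴ * form (-a) l * logFactor ζ l = form (height a ζ) l := by
    have hre : ((ζ.re : ℝ) : ℂ) = (ζ + (starRingEnd ℂ) ζ) / 2 := by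
      rw [Complex.add_conj]; simp
    apply matrix_ext_two <;>
      simp only [logFactor, form, height, Matrix.mul_apply, Fin.sum_univ_two,
        Matrix.conjTranspose_apply, Matrix.of_apply, Matrix.cons_val', Matrix.cons_val_zero,
        Matrix.cons_val_one, Matrix.cons_val_fin_one, RCLike.star_def, map_mul, map_sub, map_inv₀,
        conj_eq_inv_of_mem_sphere hl, map_one, map_zero, Complex.conj_ofReal, Complex.ofReal_sub,
        Complex.ofReal_neg, Complex.ofReal_mul, hre, Complex.ofReal_ofNat]
    · field_simp
      ring
    · ring
    · ring
    · ring
  rw [gram, frame, Matrix.conjTranspose_mul, ← h]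
  simp only [Matrix.mul_assoc]

theorem neg_phi_gram {a : ℝ} (ha : 0 < a) {z l : ℂ} (hz : z ∈ slitPlane)
    (hl : l ∈ sphere (0 : ℂ) 1) :
    -((phi a z l)ᴴ * J * phi a z l) = gram a (Complex.log z) l := by
  have h0 : l ≠ 0 := ne_of_mem_sphere hl one_ne_zero
  have hs : ((Real.sqrt a : ℝ) : ℂ) ≠ 0 := by exact_mod_cast (Real.sqrt_pos.2 ha).ne'
  have hs2 : ((Real.sqrt a : ℝ) : ℂ) * (Real.sqrt a : ℝ) = a := by
    exact_mod_cast Real.mul_self_sqrt ha.le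
  set D : M2 := !![sqrtNeg a, -l / sqrtNeg a; 0, 1 / sqrtNeg a] with hD
  have h : -(Dᴴ * J * D) = form (-a) l := by
    apply matrix_ext_two <;>
      simp only [hD, J, form, sqrtNeg, Matrix.neg_apply, Matrix.mul_apply, Fin.sum_univ_two,
        Matrix.conjTranspose_apply, Matrix.of_apply, Matrix.cons_val', Matrix.cons_val_zero,
        Matrix.cons_val_one, Matrix.cons_val_fin_one, RCLike.star_def, map_mul, map_div₀, map_neg,
        Complex.conj_I, conj_eq_inv_of_mem_sphere hl, map_one, map_zero, Complex.conj_ofReal,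
        Complex.ofReal_neg]
    · linear_combination (-Complex.I * -Complex.I) * hs2 + (a : ℂ) * Complex.I_mul_I
    · field_simp
      ring
    · field_simp
      ring
    · field_simp
      ring
  rw [phi, L_eq_frame hz, gram, ← h, ← hD, Matrix.conjTranspose_mul]
  simp only [Matrix.mul_assoc, Matrix.neg_mul, Matrix.mul_neg]

/-- `w` reverses the sign of `J`, whence the minus sign in the Hermitian loop. -/
theorem neg_conjTranspose_w {l : ℂ} (hl : l ∈ sphere (0 : ℂ) 1) : (w l)ᴴ * J * w l = -J := by
  have h0 : l ≠ 0 := ne_of_mem_sphere hl one_ne_zero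
  apply matrix_ext_two <;>
    simp [w, J, Matrix.mul_apply, conj_eq_inv_of_mem_sphere hl, h0]

/-- The plus factor of an Iwasawa factorization is determined by the Hermitian loop. -/
theorem conjTranspose_plus_mul_J {a : ℝ} (ha : 0 < a) {z l : ℂ} (hz : z ∈ slitPlane)
    (hl : l ∈ sphere (0 : ℂ) 1) {F B : M2} (hF : IsSU11 F) (h : phi a z l = F * w l * B) :
    Bᴴ * J * B = gram a (Complex.log z) l := by
  rw [← neg_phi_gram ha hz hl, h, Matrix.conjTranspose_mul, Matrix.conjTranspose_mul]
  calc Bᴴ * J * B = -(Bᴴ * ((w l)ᴴ * J * w l) * B) := by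
        rw [neg_conjTranspose_w hl]; simp
    _ = -(Bᴴ * ((w l)ᴴ * (Fᴴ * J * F) * w l) * B) := by rw [hF.2]
    _ = _ := by simp only [Matrix.mul_assoc]

/-! ### Rotational symmetry. -/

section Rotation

theorem besselArg_rotate (ζ : ℂ) (α : ℝ) (l : ℂ) :
    besselArg (ζ + α * Complex.I) (Complex.exp (2 * α * Complex.I) * l) = besselArg ζ l := by
  have h : Complex.exp (4 * (ζ + α * Complex.I))
      = Complex.exp (2 * α * Complex.I) ^ 2 * Complex.exp (4 * ζ) := by
    rw [← Complex.exp_nat_mul, ← Complex.exp_add]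
    congr 1
    push_cast
    ring
  have hμ := Complex.exp_ne_zero (2 * α * Complex.I)
  rw [besselArg, besselArg, h, mul_inv, mul_pow]
  field_simp

/-- The diagonal gauge `diag(1, μ)`. -/
def gauge (μ : ℂ) : M2 := !![1, 0; 0, μ]

/-- Turning `z` by `α` and `λ` by `2α` multiplies `z⁴` and `λ²` by the same factor and fixes the
Bessel argument; the remaining powers of `λ` are absorbed by the diagonal gauge. -/
theorem gram_rotate (a : ℝ) (ζ : ℂ) (α : ℝ) {l : ℂ} (hl : l ∈ sphere (0 : ℂ) 1) :
    gauge (Complex.exp (2 * α * Complex.I))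
      * gram a (ζ + α * Complex.I) (Complex.exp (2 * α * Complex.I) * l)
      * (gauge (Complex.exp (2 * α * Complex.I)))ᴴ = gram a ζ l := by
  set μ := Complex.exp (2 * α * Complex.I) with hμdef
  have hμ : μ ≠ 0 := Complex.exp_ne_zero _
  have hμ1 : μ ∈ sphere (0 : ℂ) 1 := by
    rw [mem_sphere_zero_iff_norm, hμdef, show (2 : ℂ) * α * Complex.I = ((2 * α : ℝ) : ℂ) * Complex.I by
      push_cast; ring, Complex.norm_exp_ofReal_mul_I]
  have hμl : μ * l ∈ sphere (0 : ℂ) 1 := by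
    rw [mem_sphere_zero_iff_norm, norm_mul, mem_sphere_zero_iff_norm.1 hμ1,
      mem_sphere_zero_iff_norm.1 hl, one_mul]
  have h0 : l ≠ 0 := ne_of_mem_sphere hl one_ne_zero
  have hh : height a (ζ + α * Complex.I) = height a ζ := by simp [height]
  have hc : core (ζ + α * Complex.I) (μ * l) * (gauge μ)ᴴ = (gauge μ)ᴴ * core ζ l := by
    rw [core, besselArg_rotate, core]
    generalize besselArg ζ l = u
    apply matrix_ext_two <;>
      simp only [gauge, Matrix.mul_apply, Fin.sum_univ_two, Matrix.conjTranspose_apply,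
        Matrix.of_apply, Matrix.cons_val', Matrix.cons_val_zero, Matrix.cons_val_one,
        Matrix.cons_val_fin_one, RCLike.star_def, map_one, map_zero,
        conj_eq_inv_of_mem_sphere hμ1] <;>
      field_simp <;> ring
  have hf : gauge μ * form (height a ζ) (μ * l) * (gauge μ)ᴴ = form (height a ζ) l := by
    apply matrix_ext_two <;>
      simp only [gauge, form, Matrix.mul_apply, Fin.sum_univ_two, Matrix.conjTranspose_apply,
        Matrix.of_apply, Matrix.cons_val', Matrix.cons_val_zero, Matrix.cons_val_one,
        Matrix.cons_val_fin_one, RCLike.star_def, map_one, map_zero, map_mul,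
        conj_eq_inv_of_mem_sphere hμ1] <;>
      field_simp <;> ring
  have hc' : gauge μ * (core (ζ + α * Complex.I) (μ * l))ᴴ = (core ζ l)ᴴ * gauge μ := by
    have := congrArg Matrix.conjTranspose hc
    simpa only [Matrix.conjTranspose_mul, Matrix.conjTranspose_conjTranspose] using this
  rw [gram_eq_core a _ hμl, gram_eq_core a _ hl, hh, ← hf]
  calc gauge μ * ((core (ζ + α * Complex.I) (μ * l))ᴴ * form (height a ζ) (μ * l)
        * core (ζ + α * Complex.I) (μ * l)) * (gauge μ)ᴴ
      = (gauge μ * (core (ζ + α * Complex.I) (μ * l))ᴴ) * form (height a ζ) (μ * l)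
        * (core (ζ + α * Complex.I) (μ * l) * (gauge μ)ᴴ) := by simp only [Matrix.mul_assoc]
    _ = _ := by rw [hc, hc']; simp only [Matrix.mul_assoc]

/-- Rotating a disc map. -/
theorem IsDiscMap.rotate {B : ℂ → M2} {ρ : ℝ} (h : IsDiscMap B ρ) {μ : ℂ}
    (hμ : μ ∈ sphere (0 : ℂ) 1) :
    IsDiscMap (fun l => gauge μ * B (μ * l) * (gauge μ)ᴴ) ρ ∧
      upperCoeff (fun l => gauge μ * B (μ * l) * (gauge μ)ᴴ) = upperCoeff B ∧
      lowerCoeff (fun l => gauge μ * B (μ * l) * (gauge μ)ᴴ) = μ ^ 2 * lowerCoeff B := by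
  have hμ0 : μ ≠ 0 := ne_of_mem_sphere hμ one_ne_zero
  have hμn : ‖μ‖ = 1 := mem_sphere_zero_iff_norm.1 hμ
  have e : ∀ l, gauge μ * B (μ * l) * (gauge μ)ᴴ
      = !![B (μ * l) 0 0, μ⁻¹ * B (μ * l) 0 1; μ * B (μ * l) 1 0, B (μ * l) 1 1] := by
    intro l
    apply matrix_ext_two <;>
      simp only [gauge, Matrix.mul_apply, Fin.sum_univ_two, Matrix.conjTranspose_apply,
        Matrix.of_apply, Matrix.cons_val', Matrix.cons_val_zero, Matrix.cons_val_one,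
        Matrix.cons_val_fin_one, RCLike.star_def, map_one, map_zero,
        conj_eq_inv_of_mem_sphere hμ] <;>
      field_simp <;> ring
  have hmaps : Set.MapsTo (fun l : ℂ => μ * l) (ball 0 1) (ball 0 1) := fun l hl => by
    simpa [hμn] using hl
  have hd : ∀ i j, DiffContOnCl ℂ (fun l => B (μ * l) i j) (ball 0 1) := fun i j =>
    (h.diffContOnCl i j).comp (differentiable_fun_id.const_mul μ).diffContOnCl hmaps
  have hsp : ∀ l ∈ sphere (0 : ℂ) 1, μ * l ∈ sphere (0 : ℂ) 1 := fun l hl => by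
    simpa [hμn] using hl
  have hderiv : ∀ i j, HasDerivAt (fun l => B (μ * l) i j) (μ * deriv (fun l => B l i j) 0) 0 := by
    intro i j
    have h1 : HasDerivAt (fun l : ℂ => μ * l) μ 0 := by
      simpa using (hasDerivAt_id (0 : ℂ)).const_mul μ
    have h2 : HasDerivAt (fun l => B l i j) (deriv (fun l => B l i j) 0) (μ * 0) := by
      simpa using h.hasDerivAt i j
    exact (h2.comp (0 : ℂ) h1).congr_deriv (mul_comm _ _)
  simp only [e]
  refine ⟨⟨fun i j => ?_, fun l hl => ?_, h.pos, ?_⟩, ?_, ?_⟩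
  · fin_cases i <;> fin_cases j
    · exact hd 0 0
    · exact (hd 0 1).const_smul μ⁻¹
    · exact (hd 1 0).const_smul μ
    · exact hd 1 1
  · rw [← h.det _ (hsp l hl), Matrix.det_fin_two_of, Matrix.det_fin_two]
    field_simp
  · simp [h.zero]
  · have := ((hderiv 0 1).const_mul μ⁻¹).deriv
    simp only [upperCoeff, Matrix.of_apply, Matrix.cons_val', Matrix.cons_val_zero,
      Matrix.cons_val_one, Matrix.cons_val_fin_one, this, mul_zero]
    field_simp
  · have := ((hderiv 1 0).const_mul μ).deriv
    simp only [lowerCoeff, Matrix.of_apply, Matrix.cons_val', Matrix.cons_val_zero,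
      Matrix.cons_val_one, Matrix.cons_val_fin_one, this, mul_zero]
    ring

theorem factorization_rotate {a : ℝ} {ζ : ℂ} {α : ℝ} {B₁ B₂ : ℂ → M2} {ρ₁ ρ₂ : ℝ}
    (h₁ : IsDiscMap B₁ ρ₁) (h₂ : IsDiscMap B₂ ρ₂)
    (e₁ : ∀ l ∈ sphere (0 : ℂ) 1, (B₁ l)ᴴ * J * B₁ l = gram a ζ l)
    (e₂ : ∀ l ∈ sphere (0 : ℂ) 1, (B₂ l)ᴴ * J * B₂ l = gram a (ζ + α * Complex.I) l) :
    ρ₂ = ρ₁ ∧ upperCoeff B₂ = upperCoeff B₁ ∧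
      Complex.exp (4 * (ζ + α * Complex.I)) * lowerCoeff B₂
        = Complex.exp (4 * ζ) * lowerCoeff B₁ := by
  set μ := Complex.exp (2 * α * Complex.I) with hμdef
  have hμ1 : μ ∈ sphere (0 : ℂ) 1 := by
    rw [mem_sphere_zero_iff_norm, hμdef, show (2 : ℂ) * α * Complex.I = ((2 * α : ℝ) : ℂ) * Complex.I by
      push_cast; ring, Complex.norm_exp_ofReal_mul_I]
  have hgg : (gauge μ)ᴴ * J * gauge μ = J := by
    have hμ0 : μ ≠ 0 := ne_of_mem_sphere hμ1 one_ne_zero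
    apply matrix_ext_two <;>
      simp [gauge, J, Matrix.mul_apply, conj_eq_inv_of_mem_sphere hμ1, hμ0]
  obtain ⟨r, ru, rl⟩ := h₂.rotate hμ1
  -- The gauge on the left of the rotated factor preserves `J`, and together with the one on the
  -- right it keeps the value at `0`; so uniqueness applies.
  obtain ⟨q1, q2, q3⟩ := h₁.unique r fun l hl => by
    have hμl : μ * l ∈ sphere (0 : ℂ) 1 := by
      rw [mem_sphere_zero_iff_norm, norm_mul, mem_sphere_zero_iff_norm.1 hμ1,
        mem_sphere_zero_iff_norm.1 hl, one_mul]
    rw [e₁ l hl, ← gram_rotate a ζ α hl, ← e₂ _ hμl]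
    simp only [Matrix.conjTranspose_mul, Matrix.conjTranspose_conjTranspose]
    calc gauge μ * ((B₂ (μ * l))ᴴ * (gauge μ)ᴴ) * J * (gauge μ * B₂ (μ * l) * (gauge μ)ᴴ)
        = gauge μ * (B₂ (μ * l))ᴴ * ((gauge μ)ᴴ * J * gauge μ) * B₂ (μ * l) * (gauge μ)ᴴ := by
          simp only [Matrix.mul_assoc]
      _ = _ := by rw [hgg]; simp only [Matrix.mul_assoc]; rfl
  refine ⟨q1, ru.symm.trans q2, ?_⟩
  -- The lower coefficient turns by `μ²`, which is exactly the change `e^{4iα}` of `z⁴`.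
  rw [← q3, rl, ← mul_assoc]
  congr 1
  rw [hμdef, ← Complex.exp_nat_mul, ← Complex.exp_add]
  congr 1
  push_cast
  ring

end Rotation

/-! ### Regularity of the Hermitian loop in `ζ` and `λ`. -/

theorem continuousOn_frame (i j : Fin 2) :
    ContinuousOn (fun p : ℂ × ℂ => frame p.1 p.2 i j) (Set.univ ×ˢ sphere 0 1) := by
  have cinv : ContinuousOn (fun p : ℂ × ℂ => p.2⁻¹) (Set.univ ×ˢ sphere (0 : ℂ) 1) :=
    ContinuousOn.inv₀ continuousOn_snd fun p hp => ne_of_mem_sphere hp.2 one_ne_zero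
  have cu : ContinuousOn (fun p : ℂ × ℂ => besselArg p.1 p.2) (Set.univ ×ˢ sphere (0 : ℂ) 1) := by
    simp only [besselArg]
    have : Continuous fun p : ℂ × ℂ => Complex.exp (4 * p.1) := by fun_prop
    exact ((cinv.pow 2).mul this.continuousOn).div_const 16
  have comp : ∀ {c : ℕ → ℂ}, ExpBounded c → ContinuousOn
      (fun p : ℂ × ℂ => series c (besselArg p.1 p.2)) (Set.univ ×ˢ sphere (0 : ℂ) 1) := fun hc =>
    hc.continuous.comp_continuousOn cu
  have b0 := comp expBounded_besselCoeff
  have b1 := comp expBounded_besselCoeff.shiftCoeff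
  have k0 := comp expBounded_companionCoeff
  have k1 := comp expBounded_companionCoeff.shiftCoeff
  have hcore : ∀ i j, ContinuousOn (fun p : ℂ × ℂ => core p.1 p.2 i j)
      (Set.univ ×ˢ sphere (0 : ℂ) 1) := by
    intro i j
    simp only [core]
    fin_cases i <;> fin_cases j
    · exact b0
    · exact (continuousOn_const.mul continuousOn_snd).mul (cu.mul b1)
    · exact (continuousOn_const.mul cinv).mul k0
    · exact b0.sub (continuousOn_const.mul (cu.mul k1))
  fin_cases i
  · simp only [Fin.zero_eta, (frame_apply _ _ j).1]
    exact hcore 0 j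
  · simp only [Fin.mk_one, (frame_apply _ _ j).2]
    exact ((cinv.mul (continuousOn_fst.sub continuousOn_const)).mul (hcore 0 j)).add (hcore 1 j)

/-- The derivative of the Hermitian loop in the direction `e`. -/
def gramDeriv (a : ℝ) (e ζ l : ℂ) : M2 :=
  e • (gram a ζ l * potential (Complex.exp (4 * ζ)) l)
    + (starRingEnd ℂ) e • ((potential (Complex.exp (4 * ζ)) l)ᴴ * gram a ζ l)

theorem hasDerivAt_gram (a : ℝ) (ζ e : ℂ) {l : ℂ} (hl : l ≠ 0) (i j : Fin 2) (t : ℝ) :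
    HasDerivAt (fun t : ℝ => gram a (ζ + t * e) l i j) (gramDeriv a e (ζ + t * e) l i j) t := by
  have hline : HasDerivAt (fun t : ℝ => ζ + t * e) e t := by
    simpa using ((hasDerivAt_id t).ofReal_comp.mul_const e).const_add ζ
  have hf : ∀ i j, HasDerivAt (fun t : ℝ => frame (ζ + t * e) l i j)
      ((frame (ζ + t * e) l * potential (Complex.exp (4 * (ζ + t * e))) l) i j * e) t := fun i j =>
    HasDerivAt.comp (h₂ := fun x => frame x l i j) t (hasDerivAt_frame hl (ζ + t * e) i j) hline
  have hfc : ∀ i j, HasDerivAt (fun t : ℝ => (starRingEnd ℂ) (frame (ζ + t * e) l i j))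
      ((starRingEnd ℂ) ((frame (ζ + t * e) l * potential (Complex.exp (4 * (ζ + t * e))) l) i j * e))
      t := fun i j => (hf i j).star
  simp only [gram, gramDeriv, conjTranspose_mul_mul_apply]
  have h := HasDerivAt.fun_sum (u := Finset.univ) fun k (_ : k ∈ Finset.univ) =>
    HasDerivAt.fun_sum (u := Finset.univ) fun m (_ : m ∈ Finset.univ) =>
      ((hfc m i).mul_const (form (-a) l m k)).fun_mul (hf k j)
  refine h.congr_deriv ?_
  generalize frame (ζ + t * e) l = f
  generalize potential (Complex.exp (4 * (ζ + t * e))) l = x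
  generalize form (-a) l = K
  simp only [Matrix.add_apply, Matrix.smul_apply, Matrix.mul_apply, Matrix.conjTranspose_apply,
    Fin.sum_univ_two, smul_eq_mul, map_mul, map_add, RCLike.star_def]
  ring

theorem continuousOn_gram (a : ℝ) (i j : Fin 2) :
    ContinuousOn (fun p : ℂ × ℂ => gram a p.1 p.2 i j) (Set.univ ×ˢ sphere 0 1) := by
  simp only [gram, conjTranspose_mul_mul_apply]
  have hK : ∀ m k, Continuous fun p : ℂ × ℂ => form (-a) p.2 m k := by
    intro m k
    simp only [form]
    fin_cases m <;> fin_cases k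
    · exact continuous_const
    · exact continuous_snd.neg
    · exact (Complex.continuous_conj.comp continuous_snd).neg
    · exact continuous_const
  refine continuousOn_finsetSum _ fun k _ => continuousOn_finsetSum _ fun m _ => ?_
  exact ((Complex.continuous_conj.comp_continuousOn (continuousOn_frame m i)).mul
    (hK m k).continuousOn).mul (continuousOn_frame k j)

theorem continuousOn_gramDeriv (a : ℝ) (e : ℂ) (i j : Fin 2) :
    ContinuousOn (fun p : ℂ × ℂ => gramDeriv a e p.1 p.2 i j) (Set.univ ×ˢ sphere 0 1) := by
  have cinv : ContinuousOn (fun p : ℂ × ℂ => p.2⁻¹) (Set.univ ×ˢ sphere (0 : ℂ) 1) :=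
    ContinuousOn.inv₀ continuousOn_snd fun p hp => ne_of_mem_sphere hp.2 one_ne_zero
  have hx : ∀ m k, ContinuousOn (fun p : ℂ × ℂ => potential (Complex.exp (4 * p.1)) p.2 m k)
      (Set.univ ×ˢ sphere (0 : ℂ) 1) := by
    intro m k
    have : Continuous fun p : ℂ × ℂ => Complex.exp (4 * p.1) := by fun_prop
    simp only [potential]
    fin_cases m <;> fin_cases k
    · exact continuousOn_const
    · exact cinv.mul this.continuousOn
    · exact cinv
    · exact continuousOn_const
  simp only [gramDeriv, Matrix.add_apply, Matrix.smul_apply, Matrix.mul_apply,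
    Matrix.conjTranspose_apply, RCLike.star_def, smul_eq_mul]
  refine ContinuousOn.add (continuousOn_const.mul (continuousOn_finsetSum _ fun k _ => ?_))
    (continuousOn_const.mul (continuousOn_finsetSum _ fun k _ => ?_))
  · exact (continuousOn_gram a i k).mul (hx k j)
  · exact (Complex.continuous_conj.comp_continuousOn (hx k i)).mul (continuousOn_gram a k j)

/-! ### The radial system. -/

/-- The family of plus factors over a region of the `ζ`-plane. -/
structure IsPlusFamily (a : ℝ) (Ω : Set ℂ) (B : ℂ → ℂ → M2) (ρ : ℂ → ℝ) : Prop where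
  isOpen : IsOpen Ω
  isDiscMap : ∀ ζ ∈ Ω, IsDiscMap (B ζ) (ρ ζ)
  gram : ∀ ζ ∈ Ω, ∀ l ∈ sphere (0 : ℂ) 1, (B ζ l)ᴴ * J * B ζ l = gram a ζ l

variable {a : ℝ} {Ω : Set ℂ} {B : ℂ → ℂ → M2} {ρ : ℂ → ℝ}

/-- Two points with equal real part are compared directly by one rotation; no path between them is
needed, so the region need not be connected. -/
theorem IsPlusFamily.radial (h : IsPlusFamily a Ω B ρ) {ζ₁ ζ₂ : ℂ} (h₁ : ζ₁ ∈ Ω) (h₂ : ζ₂ ∈ Ω)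
    (hre : ζ₁.re = ζ₂.re) :
    ρ ζ₂ = ρ ζ₁ ∧ upperCoeff (B ζ₂) = upperCoeff (B ζ₁) ∧
      Complex.exp (4 * ζ₂) * lowerCoeff (B ζ₂) = Complex.exp (4 * ζ₁) * lowerCoeff (B ζ₁) := by
  have e : ζ₂ = ζ₁ + ((ζ₂.im - ζ₁.im : ℝ) : ℂ) * Complex.I := by
    apply Complex.ext <;> simp [hre]
  have hg := h.gram ζ₂ h₂
  have := factorization_rotate (α := ζ₂.im - ζ₁.im) (h.isDiscMap ζ₁ h₁) (h.isDiscMap ζ₂ h₂)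
    (h.gram ζ₁ h₁) (by rwa [← e])
  rwa [← e] at this

theorem IsPlusFamily.eventually_mem (h : IsPlusFamily a Ω B ρ) {ζ : ℂ} (hζ : ζ ∈ Ω) (e : ℂ) :
    ∀ᶠ t : ℝ in 𝓝 0, ζ + t * e ∈ Ω := by
  have hc : ContinuousAt (fun t : ℝ => ζ + t * e) 0 := by fun_prop
  exact hc.eventually_mem (by simpa using h.isOpen.mem_nhds hζ)

/-- The same `κ₁`, `κ₂` serve all directions `e`. Only the conjugate-linear part in `e` is explicit,
so knowledge in one direction will determine the rest. -/
theorem IsPlusFamily.hasDerivAt_direction (h : IsPlusFamily a Ω B ρ) {ζ : ℂ} (hζ : ζ ∈ Ω) :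
    ∃ κ₁ κ₂ : ℂ, ∀ e : ℂ,
      HasDerivAt (fun t : ℝ => Real.log (ρ (ζ + t * e)))
        (e * (upperCoeff (B ζ) - Complex.exp (4 * ζ) * lowerCoeff (B ζ))).re 0 ∧
      HasDerivAt (fun t : ℝ => upperCoeff (B (ζ + t * e)))
        ((e * κ₁ - (starRingEnd ℂ) e * ((ρ ζ : ℂ) ^ 2)⁻¹) / (ρ ζ) ^ 2) 0 ∧
      HasDerivAt (fun t : ℝ => lowerCoeff (B (ζ + t * e)))
        ((e * κ₂ - (starRingEnd ℂ) e * ((starRingEnd ℂ) (Complex.exp (4 * ζ)) * (ρ ζ : ℂ) ^ 2))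
          * (ρ ζ) ^ 2) 0 := by
  obtain ⟨κ₁, κ₂, hκ⟩ := (h.isDiscMap ζ hζ).avg_variation (Complex.exp (4 * ζ))
  refine ⟨κ₁, κ₂, fun e => ?_⟩
  have hline : Set.MapsTo (fun p : ℝ × ℂ => (ζ + p.1 * e, p.2)) (Set.univ ×ˢ sphere (0 : ℂ) 1)
      (Set.univ ×ˢ sphere (0 : ℂ) 1) := fun p hp => ⟨Set.mem_univ _, hp.2⟩
  have hlc : Continuous fun p : ℝ × ℂ => (ζ + p.1 * e, p.2) := by fun_prop
  have hev := h.eventually_mem hζ e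
  have z0 : ζ + ((0 : ℝ) : ℂ) * e = ζ := by simp
  obtain ⟨D', hD'⟩ : ∃ D' : ℂ → M2,
      ∀ l, D' l = (B ζ l).adjugateᴴ * gramDeriv a e ζ l * (B ζ l).adjugate := ⟨_, fun _ => rfl⟩
  obtain ⟨k1, k2, k3⟩ := hκ e D' fun l hl => by rw [hD', gramDeriv, h.gram ζ hζ l hl]
  have key := hasDerivAt_factorization (B := fun t => B (ζ + t * e)) (ρ := fun t => ρ (ζ + t * e))
    (H := fun t => SmythDPW.gram a (ζ + t * e)) (H' := fun t => gramDeriv a e (ζ + t * e))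
    (hev.mono fun t ht => h.isDiscMap _ ht) (hev.mono fun t ht => h.gram _ ht)
    (fun i j l hl t => hasDerivAt_gram a ζ e (ne_of_mem_sphere hl one_ne_zero) i j t)
    (fun i j => (continuousOn_gram a i j).comp (f := fun p : ℝ × ℂ => (ζ + p.1 * e, p.2))
      hlc.continuousOn hline)
    (fun i j => (continuousOn_gramDeriv a e i j).comp (f := fun p : ℝ × ℂ => (ζ + p.1 * e, p.2))
      hlc.continuousOn hline)
    (D' := D') (fun l => by simp only [z0, hD'])
  rw [k1, k2, k3, z0] at key
  exact ⟨key.1.congr_deriv (by ring), key.2.1, key.2.2.congr_deriv (by ring)⟩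

/-- The radial system satisfied by the coefficients of the plus factor. -/
theorem IsPlusFamily.hasDerivAt_radial (h : IsPlusFamily a Ω B ρ) {ζ : ℂ} (hζ : ζ ∈ Ω) :
    HasDerivAt (fun t : ℝ => Real.log (ρ (ζ + t)))
      (upperCoeff (B ζ) - Complex.exp (4 * ζ) * lowerCoeff (B ζ)).re 0 ∧
    HasDerivAt (fun t : ℝ => upperCoeff (B (ζ + t))) (-2 * ((ρ ζ : ℂ) ^ 4)⁻¹) 0 ∧
    HasDerivAt (fun t : ℝ => Complex.exp (4 * (ζ + t)) * lowerCoeff (B (ζ + t)))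
      (-2 * Complex.exp (8 * ζ.re) * (ρ ζ : ℂ) ^ 4) 0 := by
  obtain ⟨κ₁, κ₂, hκ⟩ := h.hasDerivAt_direction hζ
  have hρ : (ρ ζ : ℂ) ≠ 0 := by exact_mod_cast (h.isDiscMap ζ hζ).pos.ne'
  have hexp : ∀ e : ℂ, HasDerivAt (fun t : ℝ => Complex.exp (4 * (ζ + t * e)))
      (Complex.exp (4 * ζ) * (4 * e)) 0 := by
    intro e
    have hline : HasDerivAt (fun t : ℝ => 4 * (ζ + t * e)) (4 * e) 0 := by
      simpa using (((hasDerivAt_id (0 : ℝ)).ofReal_comp.mul_const e).const_add ζ).const_mul 4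
    simpa using hline.cexp
  have hconst := h.eventually_mem hζ Complex.I
  have hre : ∀ t : ℝ, ζ.re = (ζ + t * Complex.I).re := fun t => by simp
  -- The direction `i` keeps `Re ζ` fixed, so these derivatives vanish; solving for `κ₁` and `κ₂`
  -- eliminates the unknowns of order two.
  have u1 : (Complex.I * κ₁ - (starRingEnd ℂ) Complex.I * ((ρ ζ : ℂ) ^ 2)⁻¹) / (ρ ζ) ^ 2 = 0 :=
    (hκ Complex.I).2.1.unique ((hasDerivAt_const (0 : ℝ) (upperCoeff (B ζ))).congr_of_eventuallyEq
      (hconst.mono fun t ht => (h.radial hζ ht (hre t)).2.1))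
  have u2 := ((hexp Complex.I).mul (hκ Complex.I).2.2).unique
    ((hasDerivAt_const (0 : ℝ) (Complex.exp (4 * ζ) * lowerCoeff (B ζ))).congr_of_eventuallyEq
      (hconst.mono fun t ht => (h.radial hζ ht (hre t)).2.2))
  have v1 : κ₁ = -((ρ ζ : ℂ) ^ 2)⁻¹ := by
    rw [div_eq_zero_iff] at u1
    have := u1.resolve_right (pow_ne_zero 2 hρ)
    rw [Complex.conj_I] at this
    have : Complex.I * (κ₁ + ((ρ ζ : ℂ) ^ 2)⁻¹) = 0 := by linear_combination this
    exact eq_neg_of_add_eq_zero_left ((mul_eq_zero.1 this).resolve_left Complex.I_ne_zero)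
  have v2 : 4 * (Complex.exp (4 * ζ) * lowerCoeff (B ζ)) + Complex.exp (4 * ζ) * κ₂ * (ρ ζ) ^ 2
      = -(Complex.exp (4 * ζ) * (starRingEnd ℂ) (Complex.exp (4 * ζ)) * (ρ ζ) ^ 4) := by
    simp only [Complex.conj_I, Complex.ofReal_zero, zero_mul, add_zero] at u2
    have : Complex.I * (4 * (Complex.exp (4 * ζ) * lowerCoeff (B ζ))
        + Complex.exp (4 * ζ) * κ₂ * (ρ ζ) ^ 2
        + Complex.exp (4 * ζ) * (starRingEnd ℂ) (Complex.exp (4 * ζ)) * (ρ ζ) ^ 4) = 0 := by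
      linear_combination u2
    exact eq_neg_of_add_eq_zero_left ((mul_eq_zero.1 this).resolve_left Complex.I_ne_zero)
  have v3 : Complex.exp (4 * ζ) * (starRingEnd ℂ) (Complex.exp (4 * ζ))
      = Complex.exp (8 * ζ.re) := by
    rw [← Complex.exp_conj, ← Complex.exp_add]
    congr 1
    have := Complex.add_conj ζ
    simp only [map_mul, Complex.conj_ofNat]
    push_cast at this
    linear_combination 4 * this
  -- In the direction `1` the linear part now equals the conjugate-linear one, hence the factors
  -- `-2`.
  obtain ⟨w1, w2, w3⟩ := hκ 1
  have w4 := (hexp 1).mul w3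
  simp only [mul_one, one_mul, map_one] at w1 w2 w4
  refine ⟨w1, w2.congr_deriv ?_, w4.congr_deriv ?_⟩
  · rw [v1]
    field_simp
    ring
  · simp only [Complex.ofReal_zero, add_zero]
    linear_combination v2 - 2 * (ρ ζ : ℂ) ^ 4 * v3

/-! ### Asymptotics of the plus factor as `Re ζ → -∞`. -/

theorem norm_avg_le_of_forall {f : ℂ → ℂ} {C : ℝ} (h : ∀ l ∈ sphere (0 : ℂ) 1, ‖f l‖ ≤ C) :
    ‖avg f‖ ≤ C := by
  have hi := intervalIntegral.norm_integral_le_of_norm_le_const (a := 0) (b := 2 * π)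
    (f := fun θ => f (circleMap 0 1 θ)) fun θ _ => h _ (circleMap_mem_sphere 0 zero_le_one θ)
  rw [sub_zero, abs_of_pos Real.two_pi_pos] at hi
  simp only [avg, circleAverage_def, norm_smul]
  rw [Real.norm_of_nonneg (inv_nonneg.2 Real.two_pi_pos.le),
    inv_mul_le_iff₀ Real.two_pi_pos]
  linarith

theorem ExpBounded.norm_series_le {c : ℕ → ℂ} (hc : ExpBounded c) {u : ℂ} (hu : ‖u‖ ≤ 1) :
    ‖series c u‖ ≤ 3 := by
  have h : HasSum (fun j : ℕ => (1 : ℝ) ^ j / (Nat.factorial j : ℝ)) (Real.exp 1) := by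
    rw [Real.exp_eq_exp_ℝ]
    exact NormedSpace.expSeries_div_hasSum_exp (1 : ℝ)
  refine (tsum_of_norm_bounded h fun j => ?_).trans (Real.exp_one_lt_d9.le.trans (by norm_num))
  rw [norm_mul, norm_pow, div_eq_inv_mul]
  exact mul_le_mul (hc j) (pow_le_pow_left₀ (norm_nonneg u) hu j) (by positivity) (by positivity)

theorem ExpBounded.norm_series_sub_le {c : ℕ → ℂ} (hc : ExpBounded c) {u : ℂ} (hu : ‖u‖ ≤ 1) :
    ‖series c u - c 0‖ ≤ 3 * ‖u‖ := by
  have := (convex_closedBall (0 : ℂ) 1).norm_image_sub_le_of_norm_hasDerivWithin_le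
    (fun x _ => (hc.hasDerivAt x).hasDerivWithinAt)
    (fun x hx => hc.shiftCoeff.norm_series_le (mem_closedBall_zero_iff.1 hx))
    (mem_closedBall_self zero_le_one) (mem_closedBall_zero_iff.2 hu)
  simpa [series_zero] using this

theorem norm_besselArg (ζ : ℂ) {l : ℂ} (hl : l ∈ sphere (0 : ℂ) 1) :
    ‖besselArg ζ l‖ = Real.exp (4 * ζ.re) / 16 := by
  rw [besselArg, norm_div, norm_mul, norm_pow, norm_inv, mem_sphere_zero_iff_norm.1 hl,
    Complex.norm_exp]
  simp

/-- The Bessel argument `u` has norm `e^{4 Re ζ} / 16`, and each entry of the difference is at most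
`12 |u|`. -/
theorem norm_core_sub_one_le {ζ l : ℂ} (hl : l ∈ sphere (0 : ℂ) 1)
    (hζ : Real.exp (4 * ζ.re) ≤ 1) (i j : Fin 2) :
    ‖(core ζ l - 1) i j‖ ≤ Real.exp (4 * ζ.re) := by
  have hu := norm_besselArg ζ hl
  have hu1 : ‖besselArg ζ l‖ ≤ 1 := by rw [hu]; linarith
  have hl1 := mem_sphere_zero_iff_norm.1 hl
  have b0 := expBounded_besselCoeff.norm_series_sub_le hu1
  have b1 := expBounded_besselCoeff.shiftCoeff.norm_series_le hu1
  have k0 := expBounded_companionCoeff.norm_series_sub_le hu1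
  have k1 := expBounded_companionCoeff.shiftCoeff.norm_series_le hu1
  have hb : besselCoeff 0 = 1 := by simp [besselCoeff]
  have hk : companionCoeff 0 = 0 := by simp [companionCoeff]
  rw [hb] at b0
  rw [hk, sub_zero] at k0
  have hpos := Real.exp_pos (4 * ζ.re)
  have hm : ∀ x : ℂ, ‖x‖ ≤ 3 → ‖besselArg ζ l * x‖ ≤ 3 * ‖besselArg ζ l‖ := fun x hx => by
    rw [norm_mul]; nlinarith [norm_nonneg (besselArg ζ l)]
  have m1 := hm _ b1
  have m2 := hm _ k1
  fin_cases i <;> fin_cases j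
  · simp only [core, Fin.zero_eta, Matrix.sub_apply, Matrix.of_apply, Matrix.cons_val',
      Matrix.cons_val_zero, Matrix.cons_val_fin_one, Matrix.one_apply_eq]
    linarith
  · simp only [core, Fin.zero_eta, Fin.mk_one, Matrix.sub_apply, Matrix.of_apply, Matrix.cons_val',
      Matrix.cons_val_zero, Matrix.cons_val_one, Matrix.cons_val_fin_one]
    rw [Matrix.one_apply_ne (by decide), sub_zero, norm_mul, norm_mul, hl1, Complex.norm_ofNat]
    linarith
  · simp only [core, Fin.zero_eta, Fin.mk_one, Matrix.sub_apply, Matrix.of_apply, Matrix.cons_val',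
      Matrix.cons_val_zero, Matrix.cons_val_one, Matrix.cons_val_fin_one]
    rw [Matrix.one_apply_ne (by decide), sub_zero, norm_mul, norm_mul, norm_inv, hl1]
    norm_num
    linarith
  · simp only [core, Fin.mk_one, Matrix.sub_apply, Matrix.of_apply, Matrix.cons_val',
      Matrix.cons_val_one, Matrix.cons_val_fin_one, Matrix.one_apply_eq]
    rw [sub_right_comm]
    refine (norm_sub_le _ _).trans ?_
    rw [norm_mul, Complex.norm_ofNat]
    linarith

/-- The plus factor of the leading term. -/
def leading (c : ℝ) (l : ℂ) : M2 :=
  !![((Real.sqrt c : ℝ) : ℂ), -l * ((Real.sqrt c : ℝ) : ℂ)⁻¹; 0, ((Real.sqrt c : ℝ) : ℂ)⁻¹]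

theorem isDiscMap_leading {c : ℝ} (hc : 0 < c) : IsDiscMap (leading c) (Real.sqrt c) where
  diffContOnCl i j := by
    refine Differentiable.diffContOnCl ?_
    simp only [leading]
    fin_cases i <;> fin_cases j
    · exact differentiable_const _
    · exact differentiable_fun_id.neg.mul_const _
    · exact differentiable_const _
    · exact differentiable_const _
  det l _ := by
    have : ((Real.sqrt c : ℝ) : ℂ) ≠ 0 := by exact_mod_cast (Real.sqrt_pos.2 hc).ne'
    simp [leading, this]
  pos := Real.sqrt_pos.2 hc
  zero := by simp [leading]

theorem leading_gram {c : ℝ} (hc : 0 < c) {l : ℂ} (hl : l ∈ sphere (0 : ℂ) 1) :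
    (leading c l)ᴴ * J * leading c l = form c l := by
  have h0 : l ≠ 0 := ne_of_mem_sphere hl one_ne_zero
  have hs : ((Real.sqrt c : ℝ) : ℂ) ≠ 0 := by exact_mod_cast (Real.sqrt_pos.2 hc).ne'
  have hs2 : ((Real.sqrt c : ℝ) : ℂ) * (Real.sqrt c : ℝ) = c := by
    exact_mod_cast Real.mul_self_sqrt hc.le
  apply matrix_ext_two <;>
    simp only [leading, J, form, Matrix.mul_apply, Fin.sum_univ_two,
      Matrix.conjTranspose_apply, Matrix.of_apply, Matrix.cons_val', Matrix.cons_val_zero,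
      Matrix.cons_val_one, Matrix.cons_val_fin_one, RCLike.star_def, map_mul, map_neg, map_inv₀,
      conj_eq_inv_of_mem_sphere hl, map_zero, Complex.conj_ofReal]
  · linear_combination hs2
  · field_simp
    ring
  · field_simp
    ring
  · field_simp
    ring

theorem norm_mul_mul_apply_le {A X C : M2} {s δ : ℝ} (hA : ∀ i j, ‖A i j‖ ≤ s)
    (hX : ∀ i j, ‖X i j‖ ≤ δ) (hC : ∀ i j, ‖C i j‖ ≤ s) (i j : Fin 2) :
    ‖(A * X * C) i j‖ ≤ 4 * (s ^ 2 * δ) := by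
  have hs : 0 ≤ s := (norm_nonneg _).trans (hA 0 0)
  have hδ : 0 ≤ δ := (norm_nonneg _).trans (hX 0 0)
  have h : ∀ k m, ‖A i m * X m k * C k j‖ ≤ s ^ 2 * δ := fun k m => by
    rw [norm_mul, norm_mul]
    calc ‖A i m‖ * ‖X m k‖ * ‖C k j‖ ≤ s * δ * s := by
          gcongr
          · exact hA i m
          · exact hX m k
          · exact hC k j
      _ = _ := by ring
  have e : (A * X * C) i j = (A i 0 * X 0 0 * C 0 j + A i 1 * X 1 0 * C 0 j)
      + (A i 0 * X 0 1 * C 1 j + A i 1 * X 1 1 * C 1 j) := by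
    simp only [Matrix.mul_apply, Fin.sum_univ_two]
    ring
  rw [e]
  have := norm_add_le (A i 0 * X 0 0 * C 0 j + A i 1 * X 1 0 * C 0 j)
    (A i 0 * X 0 1 * C 1 j + A i 1 * X 1 1 * C 1 j)
  have h1 := norm_add_le (A i 0 * X 0 0 * C 0 j) (A i 1 * X 1 0 * C 0 j)
  have h2 := norm_add_le (A i 0 * X 0 1 * C 1 j) (A i 1 * X 1 1 * C 1 j)
  linarith [h 0 0, h 0 1, h 1 0, h 1 1]

/-- The two linear terms contribute `2 η` and the quadratic one `2 η² ≤ 2 η`. -/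
theorem norm_defect_of_near_one {Y : M2} {η : ℝ} (hη : η ≤ 1) (hY : ∀ i j, ‖Y i j‖ ≤ η)
    (i j : Fin 2) : ‖((1 + Y : M2)ᴴ * J * (1 + Y) - J : M2) i j‖ ≤ 4 * η := by
  have hη0 : 0 ≤ η := (norm_nonneg _).trans (hY 0 0)
  have e : (1 + Y : M2)ᴴ * J * (1 + Y) - J = J * Y + (J * Y)ᴴ + Yᴴ * J * Y := by
    have hJ : Jᴴ = J := by apply matrix_ext_two <;> simp [J]
    rw [Matrix.conjTranspose_add, Matrix.conjTranspose_mul, hJ, Matrix.conjTranspose_one]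
    noncomm_ring
  have hJY : ∀ i j, ‖(J * Y) i j‖ ≤ η := by
    intro i j
    fin_cases i
    · simpa [J, Matrix.mul_apply] using hY 0 j
    · simpa [J, Matrix.mul_apply] using hY 1 j
  have hq : ‖(Yᴴ * J * Y) i j‖ ≤ 2 * η := by
    have e2 : (Yᴴ * J * Y) i j = (starRingEnd ℂ) (Y 0 i) * Y 0 j
        - (starRingEnd ℂ) (Y 1 i) * Y 1 j := by
      simp [J, Matrix.mul_apply]
      ring
    rw [e2]
    refine (norm_sub_le _ _).trans ?_
    rw [norm_mul, norm_mul, RCLike.norm_conj, RCLike.norm_conj]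
    nlinarith [hY 0 i, hY 0 j, hY 1 i, hY 1 j, norm_nonneg (Y 0 i), norm_nonneg (Y 0 j),
      norm_nonneg (Y 1 i), norm_nonneg (Y 1 j),
      mul_le_mul (hY 0 i) (hY 0 j) (norm_nonneg _) hη0,
      mul_le_mul (hY 1 i) (hY 1 j) (norm_nonneg _) hη0]
  rw [e, Matrix.add_apply, Matrix.add_apply, Matrix.conjTranspose_apply]
  refine (norm_add₃_le).trans ?_
  rw [norm_star]
  linarith [hJY i j, hJY j i]

/-- The constant term of the plus factor is asymptotic to that of the leading term. -/
theorem abs_div_sqrt_height_sub_one_le {a : ℝ} {ζ : ℂ} {B : ℂ → M2} {ρ : ℝ} (hB : IsDiscMap B ρ)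
    (hgram : ∀ l ∈ sphere (0 : ℂ) 1, (B l)ᴴ * J * B l = gram a ζ l) (hc : 1 ≤ height a ζ)
    (hsmall : 64 * (height a ζ * Real.exp (4 * ζ.re)) ≤ 1) :
    |ρ / Real.sqrt (height a ζ) - 1| ≤ 48 * (height a ζ * Real.exp (4 * ζ.re)) := by
  set c := height a ζ with hcdef
  set δ := Real.exp (4 * ζ.re) with hδdef
  have hδ0 : 0 < δ := Real.exp_pos _
  have hδ1 : δ ≤ 1 := by nlinarith
  have hc0 : 0 < c := by linarith
  have hC := isDiscMap_leading hc0
  have hs1 : 1 ≤ Real.sqrt c := Real.one_le_sqrt.2 hc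
  have hsinv : ‖(((Real.sqrt c : ℝ) : ℂ))⁻¹‖ ≤ Real.sqrt c := by
    rw [norm_inv, Complex.norm_of_nonneg (by positivity)]
    exact (inv_le_one_of_one_le₀ hs1).trans hs1
  have hent : ∀ l ∈ sphere (0 : ℂ) 1, ∀ i j, ‖leading c l i j‖ ≤ Real.sqrt c := by
    intro l hl i j
    have hl1 := mem_sphere_zero_iff_norm.1 hl
    simp only [leading]
    fin_cases i <;> fin_cases j
    · simp [abs_of_nonneg (Real.sqrt_nonneg c)]
    · simpa [hl1] using hsinv
    · simp
    · simpa using hsinv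
  have hadj : ∀ l ∈ sphere (0 : ℂ) 1, ∀ i j, ‖(leading c l).adjugate i j‖ ≤ Real.sqrt c := by
    intro l hl i j
    have := hent l hl
    rw [Matrix.adjugate_fin_two]
    fin_cases i <;> fin_cases j
    · exact this 1 1
    · simpa using this 0 1
    · simpa using this 1 0
    · exact this 0 0
  have hD : ∀ l ∈ sphere (0 : ℂ) 1, ∀ i j,
      ‖defect (leading c l) ((B l)ᴴ * J * B l) i j‖ ≤ 16 * (c * δ) := by
    intro l hl i j
    have h1 : leading c l * (leading c l).adjugate = 1 := by
      rw [Matrix.mul_adjugate, hC.det l hl, one_smul]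
    -- Conjugation by the leading factor `A` gives `1 + Y` with `Y = A (core - 1) A⁻¹`. The entries
    -- of `A` and `A⁻¹` are at most `√c`, so those of `Y` are at most `4 c δ`.
    have e : defect (leading c l) ((B l)ᴴ * J * B l)
        = (1 + leading c l * (core ζ l - 1) * (leading c l).adjugate)ᴴ * J
          * (1 + leading c l * (core ζ l - 1) * (leading c l).adjugate) - J := by
      have e1 : 1 + leading c l * (core ζ l - 1) * (leading c l).adjugate
          = leading c l * core ζ l * (leading c l).adjugate := by
        rw [Matrix.mul_sub, Matrix.sub_mul, Matrix.mul_one, h1]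
        abel
      rw [e1, defect, hgram l hl, gram_eq_core a ζ hl, ← hcdef, ← leading_gram hc0 hl]
      simp only [Matrix.conjTranspose_mul, Matrix.mul_assoc]
    rw [e]
    have hY := norm_mul_mul_apply_le (hent l hl) (norm_core_sub_one_le hl hδ1) (hadj l hl)
    rw [Real.sq_sqrt hc0.le] at hY
    exact (norm_defect_of_near_one (by linarith) hY i j).trans (by linarith)
  have hε0 : 0 ≤ 16 * (c * δ) := by positivity
  have key := (hC.compare hB (fun l _ => rfl) hD hε0 (by linarith)).1
  have hDavg : ‖avg (fun l => defect (leading c l) ((B l)ᴴ * J * B l) 0 0)‖ ≤ 16 * (c * δ) := by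
    exact norm_avg_le_of_forall fun l hl => hD l hl 0 0
  set x := ρ / Real.sqrt c with hx
  have hx0 : 0 < x := div_pos hB.pos hC.pos
  -- For `ε = 16 c δ ≤ 1/4` one has `8 ε² ≤ 2 ε`, which with the average bounded by `ε` makes `3 ε =
  -- 48 c δ`.
  have h3 : |x - x⁻¹| ≤ 48 * (c * δ) := by
    have := norm_le_norm_sub_add ((x - x⁻¹ : ℝ) : ℂ)
      (avg (fun l => defect (leading c l) ((B l)ᴴ * J * B l) 0 0))
    rw [Complex.norm_real, Real.norm_eq_abs] at this
    nlinarith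
  refine le_trans ?_ h3
  have e : x - x⁻¹ = (x - 1) * (1 + x⁻¹) := by field_simp; ring
  rw [e, abs_mul]
  have : 1 ≤ |1 + x⁻¹| := by
    rw [abs_of_pos (by positivity)]
    have : 0 < x⁻¹ := by positivity
    linarith
  exact le_mul_of_one_le_right (abs_nonneg _) this

/-! ### Return to the variables `z` and `r`. -/

/-- The region of the `ζ`-plane that `log` identifies with `W` minus the negative real axis. -/
def logRegion (W : Set ℂ) : Set ℂ := {ζ | Complex.exp ζ ∈ W ∧ -π < ζ.im ∧ ζ.im < π}

theorem isOpen_logRegion {W : Set ℂ} (hW : IsOpen W) : IsOpen (logRegion W) :=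
  (hW.preimage Complex.continuous_exp).inter
    ((isOpen_lt continuous_const Complex.continuous_im).inter
      (isOpen_lt Complex.continuous_im continuous_const))

theorem exp_mem_of_mem_logRegion {W : Set ℂ} {ζ : ℂ} (h : ζ ∈ logRegion W) :
    Complex.exp ζ ∈ W ∩ slitPlane ∧ Complex.log (Complex.exp ζ) = ζ := by
  have hlog : Complex.log (Complex.exp ζ) = ζ := Complex.log_exp h.2.1 h.2.2.le
  refine ⟨⟨h.1, mem_slitPlane_iff_arg.2 ⟨?_, Complex.exp_ne_zero ζ⟩⟩, hlog⟩
  rw [← Complex.log_im, hlog]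
  exact h.2.2.ne

theorem log_mem_logRegion {W : Set ℂ} {z : ℂ} (h : z ∈ W ∩ slitPlane) :
    Complex.log z ∈ logRegion W := by
  have hz := mem_slitPlane_iff_arg.1 h.2
  refine ⟨?_, ?_, ?_⟩
  · rw [Complex.exp_log hz.2]
    exact h.1
  · rw [Complex.log_im]
    exact Complex.neg_pi_lt_arg z
  · rw [Complex.log_im]
    exact lt_of_le_of_ne (Complex.arg_le_pi z) hz.1

theorem IsPosPlusLoop.isDiscMap {B : ℂ → M2} {v : ℝ} (h : IsPosPlusLoop B)
    (hv : B 0 = !![(Real.exp (v / 2) : ℂ), 0; 0, (Real.exp (-(v / 2)) : ℂ)]) :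
    IsDiscMap B (Real.exp (v / 2)) where
  diffContOnCl i j := DiffContOnCl.mk_ball (h.1.2.2.1 i j) (h.1.2.1 i j)
  det l hl := h.1.1.2.1 l (mem_sphere_zero_iff_norm.1 hl)
  pos := Real.exp_pos _
  zero := by
    rw [hv]
    push_cast [Real.exp_neg]
    rfl

theorem IsIwasawaOn.isPlusFamily {a : ℝ} (ha : 0 < a) {W : Set ℂ} (hW : IsOpen W)
    {F B : ℂ → ℂ → M2} (hFB : IsIwasawaOn (phi a) F B (W ∩ slitPlane)) {v : ℂ → ℝ}
    (hv : ∀ z ∈ W ∩ slitPlane,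
      B z 0 = !![(Real.exp (v z / 2) : ℂ), 0; 0, (Real.exp (-(v z / 2)) : ℂ)]) :
    IsPlusFamily a (logRegion W) (fun ζ => B (Complex.exp ζ))
      (fun ζ => Real.exp (v (Complex.exp ζ) / 2)) where
  isOpen := isOpen_logRegion hW
  isDiscMap ζ hζ := by
    have hz := (exp_mem_of_mem_logRegion hζ).1
    exact (hFB _ hz).2.1.isDiscMap (hv _ hz)
  gram ζ hζ l hl := by
    obtain ⟨hz, hlog⟩ := exp_mem_of_mem_logRegion hζ
    have hl1 := mem_sphere_zero_iff_norm.1 hl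
    have := conjTranspose_plus_mul_J ha hz.2 hl ((hFB _ hz).1.2 l hl1) ((hFB _ hz).2.2 l hl1)
    rwa [hlog] at this

theorem contDiffOn_two_of_hasDerivAt {S : Set ℝ} (hS : IsOpen S) {V p q : ℝ → ℝ}
    (hV : ∀ s ∈ S, HasDerivAt V (p s) s) (hp : ∀ s ∈ S, HasDerivAt p (q s) s)
    (hq : ContinuousOn q S) : ContDiffOn ℝ 2 V S := by
  have h1 : ContDiffOn ℝ 1 p S := by
    rw [show (1 : WithTop ℕ∞) = 0 + 1 by norm_num, contDiffOn_succ_iff_deriv_of_isOpen hS]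
    refine ⟨fun s hs => (hp s hs).differentiableAt.differentiableWithinAt, by simp, ?_⟩
    exact contDiffOn_zero.2 (hq.congr fun s hs => (hp s hs).deriv)
  rw [show (2 : WithTop ℕ∞) = 1 + 1 by norm_num, contDiffOn_succ_iff_deriv_of_isOpen hS]
  refine ⟨fun s hs => (hV s hs).differentiableAt.differentiableWithinAt, by simp, ?_⟩
  exact h1.congr fun s hs => (hV s hs).deriv

/-- A function constant on vertical lines inherits derivatives along horizontal directions. -/
theorem hasDerivAt_of_re_eq {E : Type*} [NormedAddCommGroup E] [NormedSpace ℝ E] {Ω : Set ℂ}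
    (hΩ : IsOpen Ω) {G : ℂ → E} {g : ℝ → E} (hg : ∀ ζ ∈ Ω, g ζ.re = G ζ) {ζ : ℂ} (hζ : ζ ∈ Ω)
    {d : E} (hd : HasDerivAt (fun t : ℝ => G (ζ + t)) d 0) : HasDerivAt g d ζ.re := by
  have hc : ContinuousAt (fun t : ℝ => ζ + (t : ℂ)) 0 := by fun_prop
  have hev : ∀ᶠ t : ℝ in 𝓝 0, ζ + (t : ℂ) ∈ Ω :=
    hc.eventually_mem (by simpa using hΩ.mem_nhds hζ)
  have h1 : HasDerivAt (fun t : ℝ => g (ζ.re + t)) d 0 := by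
    refine hd.congr_of_eventuallyEq (hev.mono fun t ht => ?_)
    simpa using hg _ ht
  have h2 : HasDerivAt (fun s : ℝ => s - ζ.re) 1 ζ.re := (hasDerivAt_id _).sub_const _
  have h3 := HasDerivAt.scomp (h := fun s : ℝ => s - ζ.re) ζ.re
    (g₁ := fun t : ℝ => g (ζ.re + t)) (by simpa using h1) h2
  simpa [Function.comp_def] using h3

/-- The logarithmic profile of a radial family of plus factors solves the sinh-Gordon equation
in the variable `s = log r`. -/
theorem IsPlusFamily.exists_profile {a : ℝ} {Ω : Set ℂ} {B : ℂ → ℂ → M2} {V : ℂ → ℝ}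
    (h : IsPlusFamily a Ω B (fun ζ => Real.exp (V ζ / 2))) :
    ∃ g p : ℝ → ℝ, (∀ ζ ∈ Ω, g ζ.re = V ζ) ∧ ∀ s ∈ Complex.re '' Ω, HasDerivAt g (p s) s ∧
      HasDerivAt p (4 * (Real.exp (8 * s) * Real.exp (2 * g s) - Real.exp (-2 * g s))) s := by
  classical
  -- One point is chosen on each vertical line that meets the region; by radiality the choice is
  -- immaterial.
  set sel : ℝ → ℂ := fun s => if hs : s ∈ Complex.re '' Ω then hs.choose else 0 with hsel
  have hsel_spec : ∀ s ∈ Complex.re '' Ω, sel s ∈ Ω ∧ (sel s).re = s := fun s hs => by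
    simp only [hsel, dif_pos hs]
    exact hs.choose_spec
  have hrad : ∀ ζ ∈ Ω, V (sel ζ.re) = V ζ ∧ upperCoeff (B (sel ζ.re)) = upperCoeff (B ζ) ∧
      Complex.exp (4 * sel ζ.re) * lowerCoeff (B (sel ζ.re))
        = Complex.exp (4 * ζ) * lowerCoeff (B ζ) := fun ζ hζ => by
    obtain ⟨h1, h2⟩ := hsel_spec ζ.re ⟨ζ, hζ, rfl⟩
    obtain ⟨k1, k2, k3⟩ := h.radial hζ h1 h2.symm
    refine ⟨?_, k2, k3⟩
    have := Real.exp_injective k1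
    linarith
  set up : ℝ → ℂ := fun s => upperCoeff (B (sel s)) with hup
  set low : ℝ → ℂ := fun s => Complex.exp (4 * sel s) * lowerCoeff (B (sel s)) with hlow
  refine ⟨fun s => V (sel s), fun s => 2 * (up s - low s).re, fun ζ hζ => (hrad ζ hζ).1, ?_⟩
  intro s hs
  obtain ⟨hζ, hre⟩ := hsel_spec s hs
  obtain ⟨d1, d2, d3⟩ := h.hasDerivAt_radial hζ
  have e1 := hasDerivAt_of_re_eq h.isOpen (g := fun s => V (sel s)) (G := V)
    (fun ζ hζ => (hrad ζ hζ).1) hζ (d := 2 * (up s - low s).re) (by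
      refine (d1.const_mul 2).congr_of_eventuallyEq (Filter.Eventually.of_forall fun t => ?_)
      simp only [Real.log_exp]
      ring)
  have e2 := hasDerivAt_of_re_eq h.isOpen (g := up) (G := fun ζ => upperCoeff (B ζ))
    (fun ζ hζ => (hrad ζ hζ).2.1) hζ d2
  have e3 := hasDerivAt_of_re_eq h.isOpen (g := low)
    (G := fun ζ => Complex.exp (4 * ζ) * lowerCoeff (B ζ)) (fun ζ hζ => (hrad ζ hζ).2.2) hζ d3
  rw [hre] at e1 e2 e3
  refine ⟨e1, ?_⟩
  have e4 := (Complex.reCLM.hasFDerivAt.comp_hasDerivAt s (e2.sub e3)).const_mul 2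
  refine e4.congr_deriv ?_
  have w1 : ((Real.exp (V (sel s) / 2) : ℝ) : ℂ) ^ 4 = ((Real.exp (2 * V (sel s)) : ℝ) : ℂ) := by
    rw [← Complex.ofReal_pow, ← Real.exp_nat_mul]
    congr 2
    push_cast
    ring
  have w2 : Complex.exp (8 * (s : ℂ)) = ((Real.exp (8 * s) : ℝ) : ℂ) := by push_cast; rfl
  rw [w1, w2, ← Complex.ofReal_inv, ← Real.exp_neg]
  have w3 : (-2 * ((Real.exp (-(2 * V (sel s))) : ℝ) : ℂ)
      - -2 * ((Real.exp (8 * s) : ℝ) : ℂ) * ((Real.exp (2 * V (sel s)) : ℝ) : ℂ))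
      = ((-2 * Real.exp (-(2 * V (sel s))) + 2 * Real.exp (8 * s) * Real.exp (2 * V (sel s)) : ℝ) : ℂ)
      := by
    push_cast
    ring
  rw [w3, Complex.reCLM_apply, Complex.ofReal_re, neg_mul 2 (V (sel s))]
  ring

/-- The product is of order `r⁴ log r`; it controls the relative error of the leading term. -/
theorem tendsto_height_mul_exp (a : ℝ) :
    Filter.Tendsto (fun r : ℝ => height a (Real.log r) * Real.exp (4 * Real.log r)) (𝓝[>] 0)
      (𝓝 0) := by
  have h1 : Filter.Tendsto (fun r : ℝ => Real.log r * r) (𝓝[>] 0) (𝓝 0) := by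
    simpa using tendsto_log_mul_rpow_nhdsGT_zero one_pos
  have h2 : Filter.Tendsto (fun r : ℝ => r) (𝓝[>] 0) (𝓝 0) :=
    tendsto_nhdsWithin_of_tendsto_nhds Filter.tendsto_id
  have h3 := ((h2.pow 4).const_mul (-a + 2 * Real.log 2)).sub
    ((h1.mul (h2.pow 3)).const_mul 2)
  simp only [ne_eq, OfNat.ofNat_ne_zero, not_false_eq_true, zero_pow, mul_zero, sub_zero] at h3
  refine h3.congr' ?_
  filter_upwards [self_mem_nhdsWithin] with r hr
  have hr0 : (0 : ℝ) < r := hr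
  have : Real.exp (4 * Real.log r) = r ^ 4 := by
    rw [show (4 : ℝ) * Real.log r = ((4 : ℕ) : ℝ) * Real.log r by norm_num, Real.exp_nat_mul,
      Real.exp_log hr0]
  rw [this, height, Complex.ofReal_re]
  ring

theorem tendsto_neg_sub_two_mul_log (a : ℝ) :
    Filter.Tendsto (fun r : ℝ => -a - 2 * Real.log r) (𝓝[>] 0) Filter.atTop := by
  have := (Real.tendsto_log_nhdsGT_zero.const_mul_atBot_of_neg (r := (-2 : ℝ)) (by norm_num))
  refine (Filter.tendsto_atTop_add_const_left _ (-a) this).congr fun r => ?_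
  ring

/-- The two radicands differ by the constant `2 log 2`, negligible against `-2 log r`. -/
theorem tendsto_sqrt_height_div (a : ℝ) :
    Filter.Tendsto (fun r : ℝ => Real.sqrt (height a (Real.log r)) /
      Real.sqrt (-a - 2 * Real.log r)) (𝓝[>] 0) (𝓝 1) := by
  have hd := tendsto_neg_sub_two_mul_log a
  have h1 : Filter.Tendsto (fun r : ℝ => 1 + 2 * Real.log 2 / (-a - 2 * Real.log r)) (𝓝[>] 0)
      (𝓝 (1 + 0)) := tendsto_const_nhds.add (hd.const_div_atTop _)
  have h2 := (Real.continuous_sqrt.tendsto _).comp h1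
  rw [add_zero, Real.sqrt_one] at h2
  refine h2.congr' ?_
  filter_upwards [hd.eventually_gt_atTop 0] with r hr
  rw [← Real.sqrt_div' _ hr.le, Function.comp_apply]
  congr 1
  rw [height, Complex.ofReal_re]
  field_simp
  ring

end SmythDPW

/-! ### The radial solution. -/

open SmythDPW in
theorem corollary3p6 (a : ℝ) (ha : 0 < a) (W : Set ℂ) (hW : IsOpen W) (h0 : (0 : ℂ) ∈ W)
    (F B : ℂ → ℂ → SmythDPW.M2)
    (hFB : SmythDPW.IsIwasawaOn (SmythDPW.phi a) F B (W ∩ Complex.slitPlane))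
    (v : ℂ → ℝ)
    (hv : ∀ z ∈ W ∩ Complex.slitPlane,
      B z 0 = !![(Real.exp (v z / 2) : ℂ), 0; 0, (Real.exp (-(v z / 2)) : ℂ)]) :
    ∃ f : ℝ → ℝ,
      (∀ z ∈ W ∩ Complex.slitPlane, v z = f ‖z‖) ∧
      ContDiffOn ℝ 2 f ((fun z : ℂ => ‖z‖) '' (W ∩ Complex.slitPlane)) ∧
      (∀ r ∈ (fun z : ℂ => ‖z‖) '' (W ∩ Complex.slitPlane),
        (1 / 4) * (deriv (deriv f) r + (1 / r) * deriv f r)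
          - r ^ 6 * Real.exp (2 * f r) + (r ^ 2)⁻¹ * Real.exp (-2 * f r) = 0) ∧
      Asymptotics.IsEquivalent (𝓝[>] (0 : ℝ))
        (fun r : ℝ => Real.exp (f r / 2)) (fun r : ℝ => Real.sqrt (-a - 2 * Real.log r)) := by
  have hfam := hFB.isPlusFamily ha hW hv
  obtain ⟨g, p, hg, hder⟩ := hfam.exists_profile (V := fun ζ => v (Complex.exp ζ))
  set S : Set ℝ := Complex.re '' logRegion W with hS
  have hSo : IsOpen S := Complex.isOpenMap_re _ (isOpen_logRegion hW)
  set R : Set ℝ := (fun z : ℂ => ‖z‖) '' (W ∩ Complex.slitPlane) with hR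
  have hpos : ∀ r ∈ R, 0 < r := by
    rintro r ⟨z, hz, rfl⟩
    exact norm_pos_iff.2 (Complex.slitPlane_ne_zero hz.2)
  have hlogS : ∀ r ∈ R, Real.log r ∈ S := by
    rintro r ⟨z, hz, rfl⟩
    exact ⟨Complex.log z, log_mem_logRegion hz, Complex.log_re z⟩
  have hRS : R = Set.Ioi 0 ∩ Real.log ⁻¹' S := by
    refine Set.Subset.antisymm (fun r hr => ⟨hpos r hr, hlogS r hr⟩) ?_
    rintro r ⟨hr, ζ, hζ, hre⟩
    refine ⟨Complex.exp ζ, (exp_mem_of_mem_logRegion hζ).1, ?_⟩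
    simp only
    rw [Complex.norm_exp, hre, Real.exp_log hr]
  -- Openness lets the second derivative at a point of `R` be computed from a formula for the first
  -- that holds only on `R`.
  have hRo : IsOpen R := by
    rw [hRS]
    exact (Real.continuousOn_log.mono fun x hx => (Set.mem_Ioi.1 hx).ne').isOpen_inter_preimage
      isOpen_Ioi hSo
  have hd1 : ∀ r ∈ R, HasDerivAt (fun r => g (Real.log r)) (p (Real.log r) / r) r := fun r hr =>
    (HasDerivAt.comp r (hder _ (hlogS r hr)).1 (Real.hasDerivAt_log (hpos r hr).ne')).congr_deriv
      (by rw [div_eq_mul_inv])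
  have hgS : ContDiffOn ℝ 2 g S := by
    refine contDiffOn_two_of_hasDerivAt hSo (fun s hs => (hder s hs).1) (fun s hs => (hder s hs).2) ?_
    have hgc : ContinuousOn g S := fun s hs => (hder s hs).1.continuousAt.continuousWithinAt
    fun_prop
  refine ⟨fun r => g (Real.log r), fun z hz => ?_, ?_, fun r hr => ?_, ?_⟩
  · have := hg _ (log_mem_logRegion hz)
    rw [Complex.log_re, Complex.exp_log (Complex.slitPlane_ne_zero hz.2)] at this
    exact this.symm
  · exact hgS.comp (Real.contDiffOn_log.mono fun r hr => (hpos r hr).ne') hlogS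
  · have hr0 := hpos r hr
    have e1 : deriv (fun r => g (Real.log r)) =ᶠ[𝓝 r] fun r => p (Real.log r) / r :=
      (hRo.eventually_mem hr).mono fun x hx => (hd1 x hx).deriv
    have hp' := HasDerivAt.comp r (hder _ (hlogS r hr)).2 (Real.hasDerivAt_log hr0.ne')
    -- With `s = log r` this turns `f_rr + f_r / r` into `g_ss / r²`, and `e^{8s} / r² = r⁶`.
    have e2 := (hp'.fun_div (hasDerivAt_id r) hr0.ne').deriv
    simp only [Function.comp_apply, id_eq] at e2
    have e3 : Real.exp (8 * Real.log r) = r ^ 8 := by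
      rw [show (8 : ℝ) * Real.log r = ((8 : ℕ) : ℝ) * Real.log r by norm_num, Real.exp_nat_mul,
        Real.exp_log hr0]
    rw [e1.deriv_eq, (hd1 r hr).deriv, e2, e3]
    field_simp
    ring
  · have hne : ∀ᶠ r in 𝓝[>] (0 : ℝ), Real.sqrt (-a - 2 * Real.log r) ≠ 0 := by
      filter_upwards [(tendsto_neg_sub_two_mul_log a).eventually_gt_atTop 0] with r hr
      exact (Real.sqrt_pos.2 hr).ne'
    rw [Asymptotics.isEquivalent_iff_tendsto_one hne]
    have hlim := tendsto_height_mul_exp a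
    have hheight : ∀ᶠ r in 𝓝[>] (0 : ℝ), 1 ≤ height a (Real.log r) := by
      filter_upwards [(tendsto_neg_sub_two_mul_log a).eventually_ge_atTop 1] with r hr
      rw [height, Complex.ofReal_re]
      have := Real.log_pos one_lt_two
      linarith
    have hsmall : ∀ᶠ r in 𝓝[>] (0 : ℝ),
        64 * (height a (Real.log r) * Real.exp (4 * Real.log r)) ≤ 1 := by
      filter_upwards [hlim.eventually_le_const (show (0 : ℝ) < 1 / 64 by norm_num)] with r hr
      linarith
    -- As `0 ∈ W`, small positive reals lie in the domain, and the profile is evaluated along them.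
    have hmem : ∀ᶠ r in 𝓝[>] (0 : ℝ), ((Real.log r : ℝ) : ℂ) ∈ logRegion W := by
      have hc : Filter.Tendsto (fun r : ℝ => (r : ℂ)) (𝓝[>] 0) (𝓝 0) :=
        tendsto_nhdsWithin_of_tendsto_nhds (by
          simpa using Complex.continuous_ofReal.tendsto 0)
      filter_upwards [hc.eventually_mem (hW.mem_nhds h0), self_mem_nhdsWithin] with r hr hr0
      refine ⟨?_, ?_, ?_⟩
      · rwa [← Complex.ofReal_exp, Real.exp_log hr0]
      · simpa using Real.pi_pos
      · simpa using Real.pi_pos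
    have hquot : Filter.Tendsto
        (fun r : ℝ => Real.exp (g (Real.log r) / 2) / Real.sqrt (height a (Real.log r)))
        (𝓝[>] 0) (𝓝 1) := by
      rw [tendsto_iff_norm_sub_tendsto_zero]
      have hup := hlim.const_mul 48
      rw [mul_zero] at hup
      refine squeeze_zero' (Filter.Eventually.of_forall fun r => norm_nonneg _) ?_ hup
      filter_upwards [hheight, hsmall, hmem] with r h1 h2 h3
      have := abs_div_sqrt_height_sub_one_le (hfam.isDiscMap _ h3) (hfam.gram _ h3) h1
        (by simpa using h2)
      have hgr := hg _ h3
      rw [Complex.ofReal_re] at hgr this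
      rw [hgr]
      exact this
    have := hquot.mul (tendsto_sqrt_height_div a)
    rw [one_mul] at this
    refine this.congr' ?_
    filter_upwards [hheight] with r hr
    have : Real.sqrt (height a (Real.log r)) ≠ 0 := (Real.sqrt_pos.2 (by linarith)).ne'
    simp only [Pi.div_apply]
    field_simp

end
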